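/- **Setting.** Let $\nu$ be the white noise measure on the space $\mathcal S'(\mathbb R)$ of real tempered distributions with its cylinder $\sigma$-algebra, i.e. the probability measure with $\int e^{i\langle\omega,\xi\rangle}\,d\nu(\omega)=e^{-\frac12\|\xi\|_{L^2}^2}$ for all $\xi\in\mathcal S(\mathbb R)$, and let $f\mapsto\langle\cdot,f\rangle$, $L^2(\mathbb R)\to L^2(\nu)$, be the continuous linear extension of the pairing with Schwartz functions. For $\gamma>0$ and $x>0$ let $$(\mathcal I_-^\gamma f)(x)=\frac1{\Gamma(\gamma)}\int_x^\infty\Big(\log\frac zx\Big)^{\gamma-1}f(z)\frac{dz}z,\qquad (\mathcal D_-^\gamma f)(x)=\Big(-x\frac{d}{dx}\Big)^{n}(\mathcal I_-^{n-\gamma}f)(x)\quad(\gamma\notin\mathbb N,\ n=\lfloor\gamma\rfloor+1)$$ be the right-sided Hadamard integral and derivative (set to $0$ for $x\le 0$), let $K_\alpha=\Gamma(\frac{\alpha+1}2)/\sqrt{\Gamma(\alpha)}$, and put $\mathcal M_-^{\alpha/2}=K_\alpha\mathcal D_-^{(1-\alpha)/2}$ if $\alpha\in(0,1)$ and $\mathcal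 M_-^{\alpha/2}=K_\alpha\mathcal I_-^{(\alpha-1)/2}$ if $\alpha\in(1,2)$. The Hadamard fractional Brownian motion (H-fBm) is the process $B^H_\alpha(t)=\langle\cdot,\mathcal M_-^{\alpha/2}1_{[0,t)}\rangle$, $t\ge0$, on $(\mathcal S'(\mathbb R),\nu)$; each $B^H_\alpha(t)$ is determined up to $\nu$-null sets. A version of it is a real process $Y$ with $Y(t)=B^H_\alpha(t)$ $\nu$-a.s. for each $t\ge0$. Path suprema and path continuity of $B_\alpha^H$ are understood for separable versions: a real process is separable if there are a countable set $D\subset[0,\infty)$ and a null set off which, for every (relatively) open $U\subset[0,\infty)$ and closed $F\subset\mathbb R$, the path takes values in $F$ on $U$ as soon as it does so on $U\cap D$. **Theorem.** Let $B$ be a standard Brownian motion (on any probability space, with a.s. continuous paths). 1. Let $\alpha\in(0,1)$. For every separable version of $B^H_\alpha$, every $t\ge0$ and every $x\in\mathbb R$, $$P\Big(\sup_{0\le s\le t}B^H_\alpha(s)>x\Big)\ \ge\ P\Big(\sup_{0\le s\le t}B(s)>x\Big),\qquad \mathbb E\Big(\sup_{0\le s\le t}B^H_\alpha(s)\Big)\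 \ge\ \mathbb E\Big(\sup_{0\le s\le t}B(s)\Big),$$ where the suprema are a.s. finite and integrable. 2. Let $\alpha\in(1,2)$. The same holds with both inequalities reversed. 3. For every $\alpha\in(0,1)\cup(1,2)$ the process $B^H_\alpha$ is stochastically continuous: $B^H_\alpha(s)\to B^H_\alpha(t)$ in probability as $s\to t$, for every $t\ge0$. 4. For $\alpha\in(1,2)$ the process $B^H_\alpha$ has a.s. continuous sample paths: it has a version by random variables with all paths continuous on $[0,\infty)$, and every separable version has a.s. continuous paths. -/

import Mathlib

open MeasureTheory ProbabilityTheory Filter Topology Set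
open scoped NNReal ENNReal SchwartzMap

noncomputable section

namespace HadamardFBM

/-! ### Right-sided Hadamard fractional operators (with parameter `μ = 0`) -/

/-- The right-sided Hadamard integral of order `γ > 0`,
`(I f)(x) = (1 / Γ(γ)) ∫_x^∞ (log (z / x))^(γ - 1) f(z) dz / z` for `x > 0`; it is extended by `0`
to `x ≤ 0`, as functions on the half line are regarded as functions on the line. -/
def hadamardIntegral (γ : ℝ) (f : ℝ → ℝ) (x : ℝ) : ℝ :=
  if 0 < x then
    (Real.Gamma γ)⁻¹ * ∫ z in Ioi x, (Real.log (z / x)) ^ (γ - 1) * f z / z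
  else 0

/-- The right-sided Hadamard derivative of non-integer order `γ > 0`,
`D f = (-x d/dx)^n (I^(n - γ) f)` with `n = ⌊γ⌋ + 1`. -/
def hadamardDeriv (γ : ℝ) (f : ℝ → ℝ) : ℝ → ℝ :=
  (fun (g : ℝ → ℝ) (x : ℝ) => -x * deriv g x)^[⌊γ⌋₊ + 1]
    (hadamardIntegral ((⌊γ⌋₊ + 1 : ℕ) - γ) f)

/-- The normalizing constant `K_α = Γ((α + 1) / 2) / √Γ(α)`. -/
def hadamardConst (α : ℝ) : ℝ := Real.Gamma ((α + 1) / 2) / √(Real.Gamma α)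

/-- The operator `M^{α/2}`, for `α ∈ (0, 2)`. -/
def hadamardOp (α : ℝ) (f : ℝ → ℝ) (x : ℝ) : ℝ :=
  if α < 1 then hadamardConst α * hadamardDeriv ((1 - α) / 2) f x
  else if α = 1 then f x
  else hadamardConst α * hadamardIntegral ((α - 1) / 2) f x

/-- The kernel `M^{α/2} 1_[0,t)`. -/
def hadamardKernel (α : ℝ) (t : ℝ≥0) : ℝ → ℝ :=
  hadamardOp α (indicator (Ico 0 (t : ℝ)) 1)

/-! ### The white noise space -/

/-- The space `𝓢'(ℝ)` of real tempered distributions on the line. -/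
abbrev SchwartzDual : Type := 𝓢(ℝ, ℝ) →L[ℝ] ℝ

/-- The `σ`-algebra on `𝓢'(ℝ)` generated by the cylinder sets. -/
instance : MeasurableSpace SchwartzDual :=
  ⨆ φ : 𝓢(ℝ, ℝ), MeasurableSpace.comap (fun ω : SchwartzDual => ω φ) (borel ℝ)

/-- `ν` is the white noise (Gaussian) measure on `𝓢'(ℝ)`: the probability measure with
`∫ exp(i ⟨ω, φ⟩) dν(ω) = exp(-‖φ‖² / 2)` for all `φ ∈ 𝓢(ℝ)`. -/
structure IsWhiteNoise (ν : Measure SchwartzDual) : Prop extends IsProbabilityMeasure ν where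
  charFun_eq : ∀ φ : 𝓢(ℝ, ℝ),
    ∫ ω, Complex.exp (Complex.I * (ω φ : ℂ)) ∂ν = Complex.exp (-(1 / 2) * ((∫ x, φ x ^ 2 : ℝ) : ℂ))

lemma measurable_pairing (φ : 𝓢(ℝ, ℝ)) : Measurable (fun ω : SchwartzDual => ω φ) := by
  have h : MeasurableSpace.comap (fun ω : SchwartzDual => ω φ) (borel ℝ)
      ≤ (inferInstance : MeasurableSpace SchwartzDual) :=
    le_iSup (fun φ : 𝓢(ℝ, ℝ) => MeasurableSpace.comap (fun ω : SchwartzDual => ω φ) (borel ℝ)) φ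
  rw [← BorelSpace.measurable_eq (α := ℝ)] at h
  exact measurable_iff_comap_le.2 h

variable {ν : Measure SchwartzDual}

lemma IsWhiteNoise.map_eq (hν : IsWhiteNoise ν) (φ : 𝓢(ℝ, ℝ)) :
    ν.map (fun ω => ω φ) = gaussianReal 0 (∫ x, φ x ^ 2).toNNReal := by
  have := hν.toIsProbabilityMeasure
  have hm := measurable_pairing φ
  have : IsProbabilityMeasure (ν.map (fun ω => ω φ)) :=
    Measure.isProbabilityMeasure_map hm.aemeasurable
  apply Measure.ext_of_charFun
  funext k
  rw [charFun_gaussianReal, charFun_apply_real,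
    integral_map hm.aemeasurable (by fun_prop)]
  have h := hν.charFun_eq (k • φ)
  have e : ∫ x, (k • φ) x ^ 2 = k ^ 2 * ∫ x, φ x ^ 2 := by
    rw [← integral_const_mul]
    congr 1; ext x
    simp [mul_pow]
  rw [e] at h
  have h0 : 0 ≤ ∫ x, φ x ^ 2 := integral_nonneg fun x => sq_nonneg _
  rw [show (((∫ x, φ x ^ 2).toNNReal : ℝ) : ℂ) = ((∫ x, φ x ^ 2 : ℝ) : ℂ) by
    rw [Real.coe_toNNReal _ h0]]
  convert h using 2
  · ext ω
    simp
    ring_nf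
  · push_cast
    ring

lemma IsWhiteNoise.memLp (hν : IsWhiteNoise ν) (φ : 𝓢(ℝ, ℝ)) :
    MemLp (fun ω : SchwartzDual => ω φ) 2 ν := by
  have h := memLp_id_gaussianReal (μ := 0) (v := (∫ x, φ x ^ 2).toNNReal) 2
  rw [← hν.map_eq φ] at h
  exact (memLp_map_measure_iff h.1 (measurable_pairing φ).aemeasurable).1 h

lemma IsWhiteNoise.integral_sq (hν : IsWhiteNoise ν) (φ : 𝓢(ℝ, ℝ)) :
    ∫ ω, (ω φ) ^ 2 ∂ν = ∫ x, φ x ^ 2 := by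
  have h0 : 0 ≤ ∫ x, φ x ^ 2 := integral_nonneg fun x => sq_nonneg _
  have h := variance_id_gaussianReal (μ := 0) (v := (∫ x, φ x ^ 2).toNNReal)
  rw [variance_of_integral_eq_zero (by fun_prop) (by simp), ← hν.map_eq φ,
    integral_map (measurable_pairing φ).aemeasurable (by fun_prop), Real.coe_toNNReal _ h0] at h
  simpa using h

/-- The linear map `φ ↦ ⟨·, φ⟩` from `𝓢(ℝ)` to `L²(ν)`. -/
def pairingLp (hν : IsWhiteNoise ν) : 𝓢(ℝ, ℝ) →ₗ[ℝ] Lp ℝ 2 ν where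
  toFun φ := (hν.memLp φ).toLp
  map_add' φ ψ := by
    rw [← MemLp.toLp_add]
    congr 1
    ext ω
    simp
  map_smul' c φ := by
    rw [RingHom.id_apply, ← MemLp.toLp_const_smul]
    congr 1
    ext ω
    simp

/-- The continuous linear extension `f ↦ ⟨·, f⟩` of the pairing to a map `L²(ℝ) → L²(ν)`. -/
def whiteNoisePairing (hν : IsWhiteNoise ν) : Lp ℝ 2 (volume : Measure ℝ) →L[ℝ] Lp ℝ 2 ν :=
  (pairingLp hν).extendOfNorm (SchwartzMap.toLpCLM ℝ ℝ 2 (volume : Measure ℝ)).toLinearMap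

lemma norm_pairingLp (hν : IsWhiteNoise ν) (φ : 𝓢(ℝ, ℝ)) :
    ‖pairingLp hν φ‖ = ‖φ.toLp 2 (volume : Measure ℝ)‖ := by
  have a : ‖pairingLp hν φ‖ ^ 2 = ∫ ω, (ω φ) ^ 2 ∂ν := by
    rw [← real_inner_self_eq_norm_sq, L2.inner_def]
    apply integral_congr_ae
    filter_upwards [(hν.memLp φ).coeFn_toLp] with ω h
    simp [pairingLp, h, pow_two]
  have b : ‖φ.toLp 2 (volume : Measure ℝ)‖ ^ 2 = ∫ x, φ x ^ 2 := by
    rw [← real_inner_self_eq_norm_sq, L2.inner_def]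
    apply integral_congr_ae
    filter_upwards [φ.coeFn_toLp 2 volume] with ω h
    simp [h, pow_two]
  rw [← sq_eq_sq₀ (norm_nonneg _) (norm_nonneg _), a, b, hν.integral_sq]

/-- `whiteNoisePairing` does extend the pairing with Schwartz functions. -/
lemma whiteNoisePairing_toLp (hν : IsWhiteNoise ν) (φ : 𝓢(ℝ, ℝ)) :
    whiteNoisePairing hν (φ.toLp 2 (volume : Measure ℝ)) = (hν.memLp φ).toLp :=
  LinearMap.extendOfNorm_eq (f := pairingLp hν)
    (e := (SchwartzMap.toLpCLM ℝ ℝ 2 (volume : Measure ℝ)).toLinearMap)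
    (SchwartzMap.denseRange_toLpCLM (by simp))
    ⟨1, fun φ => by simpa using (norm_pairingLp hν φ).le⟩ φ

/-! ### The Hadamard fractional Brownian motion -/

open Classical in
/-- The Hadamard fractional Brownian motion `B^H_α(t) = ⟨·, M^{α/2} 1_[0,t)⟩`, an element of `L²(ν)`
for each `t ≥ 0`, i.e. a random variable that is defined up to `ν`-null sets. For `α ∈ (0, 2)` the
kernel is square integrable (the value `0` otherwise is irrelevant). -/
def hadamardFBM (hν : IsWhiteNoise ν) (α : ℝ) (t : ℝ≥0) : Lp ℝ 2 ν :=
  if h : MemLp (hadamardKernel α t) 2 (volume : Measure ℝ) then whiteNoisePairing hν h.toLp else 0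

/-- `Y` is a version (modification) of the Hadamard fractional Brownian motion. -/
def IsVersion (hν : IsWhiteNoise ν) (α : ℝ) (Y : ℝ≥0 → SchwartzDual → ℝ) : Prop :=
  ∀ t, Y t =ᵐ[ν] hadamardFBM hν α t

variable {Ω : Type*} [MeasurableSpace Ω]

/-- Separability of a real process in the sense of Doob: there are a countable set `D` of times and
a null set such that, off the null set, for all open sets `U` of times and all closed sets `F` of
values, the path stays in `F` on `U` as soon as it does so on `U ∩ D`. -/
def IsSeparableProcess (X : ℝ≥0 → Ω → ℝ) (P : Measure Ω) : Prop :=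
  ∃ D : Set ℝ≥0, D.Countable ∧ ∀ᵐ ω ∂P, ∀ U : Set ℝ≥0, IsOpen U → ∀ F : Set ℝ, IsClosed F →
    (∀ s ∈ U ∩ D, X s ω ∈ F) → ∀ s ∈ U, X s ω ∈ F

/-- The running supremum `sup_{0 ≤ s ≤ t} X_s`. -/
def runningSup (X : ℝ≥0 → Ω → ℝ) (t : ℝ≥0) (ω : Ω) : ℝ := ⨆ s : Icc (0 : ℝ≥0) t, X s ω

/-- The path of `ω` is bounded above on `[0, t]`. -/
def PathBddAbove (X : ℝ≥0 → Ω → ℝ) (t : ℝ≥0) (ω : Ω) : Prop :=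
  BddAbove ((fun s => X s ω) '' Icc 0 t)

end HadamardFBM

end

open HadamardFBM

/-! Up to null sets the kernel is `Γ(α)^(-1/2) (log (t/x))^((α-1)/2)` on `(0, t)` and zero
elsewhere. The pairing sends `f` to a centered Gaussian variable of variance `‖f‖²`, so every
version of the process is centered Gaussian with covariance `R(s,t)` equal to the inner product of
the kernels. The substitution `x = t e^(-u)` turns `R(t,t)` into a Gamma integral with value `t`, so
the variances are those of Brownian motion. For `s ≤ t`, replacing `log (s/x)` by the larger `log
(t/x)` in one factor lowers the integrand of `R(s,s)` if `α < 1` and raises it if `α > 1`. Hence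
`R(s,t)` lies below, respectively above, `min s t`.

Slepian's inequality (`slepian`) says that with equal variances larger covariances make the maximum
stochastically smaller. It is proved by Lindeberg replacement: the covariance is moved from `A` to
`B` in `n` small steps, each with a favourable second-order term and an error of order `n^(-3/2)`.
Path continuity carries it from finite sets of times to `[0, t]` (`measure_lt_runningSup_le`). The
means follow by integrating tails, the suprema being nonnegative because the processes vanish at
time zero.

Regularity rests on `exists_increment_le`: the increment variances are locally Hölder. This gives
continuity in `L²`, hence stochastic continuity. High Gaussian moments and Kolmogorov's criterion
give a continuous version with integrable bounds on compact intervals, for `α < 1` as well, and a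
separable version is indistinguishable from it. -/

namespace HadamardFBM

/-! ### Slepian's inequality -/

/-- A crude form of Taylor's formula of order two. -/
lemma abs_taylor_two_le {f f₁ f₂ f₃ : ℝ → ℝ} {K : ℝ} (h₁ : ∀ x, HasDerivAt f (f₁ x) x)
    (h₂ : ∀ x, HasDerivAt f₁ (f₂ x) x) (h₃ : ∀ x, HasDerivAt f₂ (f₃ x) x)
    (hK : ∀ x, |f₃ x| ≤ K) {s : ℝ} (hs : 0 ≤ s) :
    |f s - f 0 - f₁ 0 * s - f₂ 0 * (s ^ 2 / 2)| ≤ K * s ^ 3 := by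
  have hK0 : 0 ≤ K := (abs_nonneg _).trans (hK 0)
  have key : ∀ (g g' : ℝ → ℝ) (C t : ℝ), 0 ≤ t → (∀ x, HasDerivAt g (g' x) x) →
      (∀ x ∈ Icc 0 t, |g' x| ≤ C) → |g t - g 0| ≤ C * t := by
    intro g g' C t ht hg hC
    have := (convex_Icc (0 : ℝ) t).norm_image_sub_le_of_norm_hasDerivWithin_le (f := g) (f' := g')
      (fun x _ => (hg x).hasDerivWithinAt) (fun x hx => by simpa using hC x hx)
      (left_mem_Icc.2 ht) (right_mem_Icc.2 ht)
    simpa [abs_of_nonneg ht] using this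
  have e₂ : ∀ t, 0 ≤ t → |f₂ t - f₂ 0| ≤ K * t := fun t ht =>
    key f₂ f₃ K t ht h₃ (fun x _ => hK x)
  have e₁ : ∀ t, 0 ≤ t → |f₁ t - f₁ 0 - f₂ 0 * t| ≤ K * t ^ 2 := by
    intro t ht
    have := key (fun x => f₁ x - f₂ 0 * x) (fun x => f₂ x - f₂ 0) (K * t) t ht
      (fun x => ((h₂ x).fun_sub ((hasDerivAt_id' x).const_mul (f₂ 0))).congr_deriv (by ring))
      (fun x hx => (e₂ x hx.1).trans (by gcongr; exact hx.2))
    calc _ = |f₁ t - f₂ 0 * t - (f₁ 0 - f₂ 0 * 0)| := by congr 1; ring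
      _ ≤ _ := this
      _ = _ := by ring
  have := key (fun x => f x - f₁ 0 * x - f₂ 0 * (x ^ 2 / 2))
    (fun x => f₁ x - f₁ 0 - f₂ 0 * x) (K * s ^ 2) s hs
    (fun x => (((h₁ x).fun_sub ((hasDerivAt_id' x).const_mul (f₁ 0))).fun_sub
        ((((hasDerivAt_id' x).fun_pow 2).div_const 2).const_mul (f₂ 0))).congr_deriv
          (by push_cast; ring))
    (fun x hx => (e₁ x hx.1).trans (by gcongr <;> [exact hx.1; exact hx.2]))
  calc _ = |f s - f₁ 0 * s - f₂ 0 * (s ^ 2 / 2) - (f 0 - f₁ 0 * 0 - f₂ 0 * (0 ^ 2 / 2))| := by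
        congr 1; ring
    _ ≤ _ := this
    _ = _ := by ring

variable {ι : Type*} [Fintype ι]

/-- Smooth nondecreasing nonnegative functions with three bounded derivatives. -/
structure IsSmoothPenalty (ψ ψ₁ ψ₂ ψ₃ : ℝ → ℝ) (K : ℝ) : Prop where
  nonneg : ∀ x, 0 ≤ ψ x
  deriv_nonneg : ∀ x, 0 ≤ ψ₁ x
  hasDerivAt₀ : ∀ x, HasDerivAt ψ (ψ₁ x) x
  hasDerivAt₁ : ∀ x, HasDerivAt ψ₁ (ψ₂ x) x
  hasDerivAt₂ : ∀ x, HasDerivAt ψ₂ (ψ₃ x) x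
  bound₁ : ∀ x, |ψ₁ x| ≤ K
  bound₂ : ∀ x, |ψ₂ x| ≤ K
  bound₃ : ∀ x, |ψ₃ x| ≤ K

lemma abs_sum_mul_pow_le {K : ℝ} (a y : ι → ℝ) (ha : ∀ i, |a i| ≤ K) (k : ℕ) (hk : k ≠ 0) :
    |∑ i, a i * y i ^ k| ≤ K * (∑ i, |y i|) ^ k := by
  -- Without indices nothing forces `0 ≤ K`; there `k ≠ 0` makes the right side vanish.
  rcases isEmpty_or_nonempty ι with h | ⟨⟨i₀⟩⟩
  · simp [hk]
  have hK : 0 ≤ K := (abs_nonneg _).trans (ha i₀)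
  calc |∑ i, a i * y i ^ k| ≤ ∑ i, |a i * y i ^ k| := Finset.abs_sum_le_sum_abs _ _
    _ ≤ ∑ i, K * |y i| ^ k := by
        gcongr with i
        rw [abs_mul, abs_pow]
        gcongr
        exact ha i
    _ = K * ∑ i, |y i| ^ k := by rw [Finset.mul_sum]
    _ ≤ K * (∑ i, |y i|) ^ k := by
        gcongr
        obtain ⟨m, rfl⟩ := Nat.exists_eq_succ_of_ne_zero hk
        calc ∑ i, |y i| ^ (m + 1) ≤ ∑ i, |y i| * (∑ j, |y j|) ^ m := by
              gcongr with i
              rw [pow_succ']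
              gcongr
              exact Finset.single_le_sum (f := fun j => |y j|) (fun j _ => abs_nonneg _)
                (Finset.mem_univ i)
          _ = (∑ j, |y j|) ^ (m + 1) := by rw [← Finset.sum_mul, pow_succ']

/-- The extra factor `y i ^ k` gives the derivative the same shape, so one statement serves for all
three derivatives along a line. -/
lemma hasDerivAt_sum_line {g g' : ℝ → ℝ} (hg : ∀ x, HasDerivAt g (g' x) x) (w y : ι → ℝ)
    (k : ℕ) (s : ℝ) :
    HasDerivAt (fun s => ∑ i, g (w i + s * y i) * y i ^ k)
      (∑ i, g' (w i + s * y i) * y i ^ (k + 1)) s := by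
  refine HasDerivAt.fun_sum fun i _ => ?_
  have h := (hg (w i + s * y i)).comp s
    (((hasDerivAt_id' s).mul_const (y i)).const_add (w i))
  exact (h.mul_const (y i ^ k)).congr_deriv (by ring)

namespace IsSmoothPenalty

variable {ψ ψ₁ ψ₂ ψ₃ : ℝ → ℝ} {K : ℝ}

/-- With `H` the penalty sum along the line and `F = exp (-H)`, one has `F' = -H' F`, `F'' = (H'² -
H'') F` and `F''' = (3 H' H'' - H'³ - H''') F`. Since `ψ ≥ 0`, `F ≤ 1`, and the bounds on `ψ₁`,
`ψ₂`, `ψ₃` yield the constant `3 K² + K³ + K`. -/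
lemma abs_taylor_exp_le (h : IsSmoothPenalty ψ ψ₁ ψ₂ ψ₃ K) (w y : ι → ℝ) {s : ℝ} (hs : 0 ≤ s) :
    |Real.exp (-∑ i, ψ (w i + s * y i)) - Real.exp (-∑ i, ψ (w i))
        + (∑ i, ψ₁ (w i) * y i) * Real.exp (-∑ i, ψ (w i)) * s
        - ((∑ i, ψ₁ (w i) * y i) ^ 2 - ∑ i, ψ₂ (w i) * y i ^ 2) * Real.exp (-∑ i, ψ (w i))
          * (s ^ 2 / 2)|
      ≤ ((3 * K ^ 2 + K ^ 3 + K) * (∑ i, |y i|) ^ 3) * s ^ 3 := by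
  set H : ℝ → ℝ := fun s => ∑ i, ψ (w i + s * y i) * y i ^ 0 with hH
  set H₁ : ℝ → ℝ := fun s => ∑ i, ψ₁ (w i + s * y i) * y i ^ 1 with hH₁
  set H₂ : ℝ → ℝ := fun s => ∑ i, ψ₂ (w i + s * y i) * y i ^ 2 with hH₂
  set H₃ : ℝ → ℝ := fun s => ∑ i, ψ₃ (w i + s * y i) * y i ^ 3 with hH₃
  have d₀ : ∀ s, HasDerivAt H (H₁ s) s := hasDerivAt_sum_line h.hasDerivAt₀ w y 0
  have d₁ : ∀ s, HasDerivAt H₁ (H₂ s) s := hasDerivAt_sum_line h.hasDerivAt₁ w y 1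
  have d₂ : ∀ s, HasDerivAt H₂ (H₃ s) s := hasDerivAt_sum_line h.hasDerivAt₂ w y 2
  have f₁ : ∀ s, HasDerivAt (fun s => Real.exp (-H s)) (-H₁ s * Real.exp (-H s)) s := fun s =>
    (d₀ s).fun_neg.exp.congr_deriv (by ring)
  have f₂ : ∀ s, HasDerivAt (fun s => -H₁ s * Real.exp (-H s))
      ((H₁ s ^ 2 - H₂ s) * Real.exp (-H s)) s := fun s =>
    ((d₁ s).fun_neg.fun_mul (f₁ s)).congr_deriv (by ring)
  have f₃ : ∀ s, HasDerivAt (fun s => (H₁ s ^ 2 - H₂ s) * Real.exp (-H s))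
      ((3 * H₁ s * H₂ s - H₁ s ^ 3 - H₃ s) * Real.exp (-H s)) s := fun s =>
    ((((d₁ s).fun_pow 2).fun_sub (d₂ s)).fun_mul (f₁ s)).congr_deriv (by push_cast; ring)
  have hb : ∀ s, |(3 * H₁ s * H₂ s - H₁ s ^ 3 - H₃ s) * Real.exp (-H s)|
      ≤ (3 * K ^ 2 + K ^ 3 + K) * (∑ i, |y i|) ^ 3 := by
    intro s
    have b₁ : |H₁ s| ≤ K * (∑ i, |y i|) ^ 1 :=
      abs_sum_mul_pow_le _ y (fun i => h.bound₁ _) 1 (by norm_num)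
    have b₂ : |H₂ s| ≤ K * (∑ i, |y i|) ^ 2 :=
      abs_sum_mul_pow_le _ y (fun i => h.bound₂ _) 2 (by norm_num)
    have b₃ : |H₃ s| ≤ K * (∑ i, |y i|) ^ 3 :=
      abs_sum_mul_pow_le _ y (fun i => h.bound₃ _) 3 (by norm_num)
    have hexp : Real.exp (-H s) ≤ 1 := by
      rw [Real.exp_le_one_iff, neg_nonpos]
      exact Finset.sum_nonneg fun i _ => by simpa using h.nonneg _
    have hK : 0 ≤ K := (abs_nonneg _).trans (h.bound₁ 0)
    have hS : 0 ≤ ∑ i, |y i| := Finset.sum_nonneg fun i _ => abs_nonneg _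
    rw [abs_mul, abs_of_pos (Real.exp_pos _)]
    calc |3 * H₁ s * H₂ s - H₁ s ^ 3 - H₃ s| * Real.exp (-H s)
        ≤ |3 * H₁ s * H₂ s - H₁ s ^ 3 - H₃ s| * 1 := by gcongr
      _ ≤ (|3 * H₁ s * H₂ s| + |H₁ s ^ 3|) + |H₃ s| := by
        rw [mul_one]
        exact (abs_sub _ _).trans (by gcongr; exact abs_sub _ _)
      _ = 3 * |H₁ s| * |H₂ s| + |H₁ s| ^ 3 + |H₃ s| := by simp [abs_mul, abs_pow]
      _ ≤ 3 * (K * (∑ i, |y i|) ^ 1) * (K * (∑ i, |y i|) ^ 2) + (K * (∑ i, |y i|) ^ 1) ^ 3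
          + K * (∑ i, |y i|) ^ 3 := by gcongr
      _ = _ := by ring
  have := abs_taylor_two_le f₁ f₂ f₃ hb hs
  simp only [hH, hH₁, hH₂, zero_mul, add_zero, pow_zero, mul_one, pow_one] at this
  convert this using 2
  ring

lemma continuous (h : IsSmoothPenalty ψ ψ₁ ψ₂ ψ₃ K) : Continuous ψ :=
  continuous_iff_continuousAt.2 fun x => (h.hasDerivAt₀ x).continuousAt

lemma exp_neg_sum_mem (h : IsSmoothPenalty ψ ψ₁ ψ₂ ψ₃ K) (w : ι → ℝ) :
    ‖Real.exp (-∑ i, ψ (w i))‖ ≤ 1 := by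
  rw [Real.norm_eq_abs, Real.abs_exp, Real.exp_le_one_iff, neg_nonpos]
  exact Finset.sum_nonneg fun i _ => h.nonneg _

lemma integrable_exp (h : IsSmoothPenalty ψ ψ₁ ψ₂ ψ₃ K) {μ : Measure (EuclideanSpace ℝ ι)}
    [IsFiniteMeasure μ] (w : EuclideanSpace ℝ ι) (s : ℝ) :
    Integrable (fun y => Real.exp (-∑ i, ψ (w i + s * y i))) μ := by
  have := h.continuous
  refine (integrable_const (1 : ℝ)).mono (by fun_prop) (ae_of_all _ fun y => ?_)
  simpa using h.exp_neg_sum_mem (fun i => w i + s * y i)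

end IsSmoothPenalty

/-- A translate of `Real.smoothTransition` works: it is constant off `[0, 1]`, so its derivatives
are continuous with compact support, hence bounded. -/
lemma exists_isSmoothPenalty (c : ℝ) : ∃ ψ ψ₁ ψ₂ ψ₃ : ℝ → ℝ, ∃ K,
    IsSmoothPenalty ψ ψ₁ ψ₂ ψ₃ K ∧ (∀ x ≤ c, ψ x = 0) ∧ ∀ x, c < x → 0 < ψ x := by
  have hsm : ContDiff ℝ 3 Real.smoothTransition := Real.smoothTransition.contDiff
  have c1 : ContDiff ℝ 2 (deriv Real.smoothTransition) :=
    ((contDiff_succ_iff_deriv (n := 2)).1 hsm).2.2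
  have c2 : ContDiff ℝ 1 (deriv (deriv Real.smoothTransition)) :=
    ((contDiff_succ_iff_deriv (n := 1)).1 c1).2.2
  have c3 : Continuous (deriv (deriv (deriv Real.smoothTransition))) :=
    c2.continuous_deriv le_rfl
  have s1 : HasCompactSupport (deriv Real.smoothTransition) := by
    refine HasCompactSupport.of_support_subset_isCompact (isCompact_Icc (a := (0 : ℝ)) (b := 1)) ?_
    intro x hx
    by_contra hx'
    apply hx
    rw [mem_Icc, not_and_or, not_le, not_le] at hx'
    rcases hx' with hx' | hx'
    · have : Real.smoothTransition =ᶠ[𝓝 x] fun _ => 0 := by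
        filter_upwards [Iio_mem_nhds hx'] with y hy
        exact Real.smoothTransition.zero_of_nonpos (le_of_lt hy)
      rw [this.deriv_eq, deriv_const]
    · have : Real.smoothTransition =ᶠ[𝓝 x] fun _ => 1 := by
        filter_upwards [Ioi_mem_nhds hx'] with y hy
        exact Real.smoothTransition.one_of_one_le (le_of_lt hy)
      rw [this.deriv_eq, deriv_const]
  obtain ⟨K₁, hK₁⟩ := c1.continuous.bounded_above_of_compact_support s1
  obtain ⟨K₂, hK₂⟩ := c2.continuous.bounded_above_of_compact_support s1.deriv
  obtain ⟨K₃, hK₃⟩ := c3.bounded_above_of_compact_support s1.deriv.deriv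
  have shift : ∀ {f : ℝ → ℝ}, Differentiable ℝ f → ∀ x,
      HasDerivAt (fun x => f (x - c)) (deriv f (x - c)) x := fun {f} hf x => by
    simpa using (hf (x - c)).hasDerivAt.comp_sub_const x c
  refine ⟨fun x => Real.smoothTransition (x - c), fun x => deriv Real.smoothTransition (x - c),
    fun x => deriv (deriv Real.smoothTransition) (x - c),
    fun x => deriv (deriv (deriv Real.smoothTransition)) (x - c), max K₁ (max K₂ K₃), ?_, ?_, ?_⟩
  · refine ⟨fun x => Real.smoothTransition.nonneg _, fun x => ?_, shift (hsm.differentiable (by simp)),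
      shift (c1.differentiable (by simp)), shift (c2.differentiable (by simp)), fun x => ?_,
      fun x => ?_, fun x => ?_⟩
    · exact Real.smoothTransition.monotone.deriv_nonneg
    · exact (hK₁ _).trans (le_max_left _ _)
    · exact (hK₂ _).trans ((le_max_left _ _).trans (le_max_right _ _))
    · exact (hK₃ _).trans ((le_max_right _ _).trans (le_max_right _ _))
  · exact fun x hx => Real.smoothTransition.zero_of_nonpos (by linarith)
  · exact fun x hx => Real.smoothTransition.pos_of_pos (by linarith)

end HadamardFBM

/-! ### Gaussian vectors: convolution, scaling, moments, and the Lindeberg replacement. -/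

namespace HadamardFBM

variable {ι : Type*} [Fintype ι] [DecidableEq ι]

lemma multivariateGaussian_conv {A B : Matrix ι ι ℝ} (hA : A.PosSemidef) (hB : B.PosSemidef) :
    (multivariateGaussian 0 A).conv (multivariateGaussian 0 B) = multivariateGaussian 0 (A + B) := by
  apply Measure.ext_of_charFun
  ext t
  rw [charFun_conv, charFun_multivariateGaussian hA, charFun_multivariateGaussian hB,
    charFun_multivariateGaussian (hA.add hB), ← Complex.exp_add, Matrix.add_mulVec,
    dotProduct_add]
  congr 1
  simp
  ring

lemma multivariateGaussian_map_sqrt_smul {A : Matrix ι ι ℝ} (hA : A.PosSemidef) {δ : ℝ}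
    (hδ : 0 ≤ δ) :
    (multivariateGaussian 0 A).map (fun y => √δ • y) = multivariateGaussian 0 (δ • A) := by
  have : IsProbabilityMeasure ((multivariateGaussian 0 A).map (fun y => √δ • y)) :=
    Measure.isProbabilityMeasure_map (by fun_prop)
  apply Measure.ext_of_charFun
  ext t
  rw [charFun_map_smul, charFun_multivariateGaussian hA,
    charFun_multivariateGaussian (hA.smul hδ), Matrix.smul_mulVec, dotProduct_smul]
  congr 1
  simp only [inner_zero_right, Complex.ofReal_zero, zero_mul, WithLp.ofLp_smul, Matrix.mulVec_smul,
    dotProduct_smul, smul_dotProduct, smul_eq_mul]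
  rw [← mul_assoc, Real.mul_self_sqrt hδ]

lemma integrable_sum_abs_pow (A : Matrix ι ι ℝ) (k : ℕ) :
    Integrable (fun y : EuclideanSpace ℝ ι => (∑ i, |y i|) ^ k) (multivariateGaussian 0 A) := by
  rcases Nat.eq_zero_or_pos k with rfl | hk
  · simp
  have h : MemLp (fun y : EuclideanSpace ℝ ι => ∑ i, |y i|) k (multivariateGaussian 0 A) := by
    refine memLp_finsetSum _ fun i _ => ?_
    have := (IsGaussian.memLp_id (multivariateGaussian 0 A) k (by simp)).norm
    refine this.mono (by fun_prop) (ae_of_all _ fun y => ?_)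
    simpa using PiLp.norm_apply_le y i
  have h2 := h.integrable_norm_pow hk.ne'
  refine h2.congr (ae_of_all _ fun y => ?_)
  simp only [Real.norm_eq_abs]
  rw [abs_of_nonneg (Finset.sum_nonneg fun i _ => abs_nonneg _)]

lemma integrable_eval_multivariateGaussian (A : Matrix ι ι ℝ) (i : ι) :
    Integrable (fun y : EuclideanSpace ℝ ι => y i) (multivariateGaussian 0 A) := by
  refine (integrable_sum_abs_pow A 1).mono (by fun_prop) (ae_of_all _ fun y => ?_)
  rw [pow_one, Real.norm_eq_abs, Real.norm_eq_abs]
  exact (Finset.single_le_sum (f := fun j => |y j|) (fun j _ => abs_nonneg _)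
    (Finset.mem_univ i)).trans (le_abs_self _)

lemma integral_eval_multivariateGaussian (A : Matrix ι ι ℝ) (i : ι) :
    ∫ y : EuclideanSpace ℝ ι, y i ∂(multivariateGaussian 0 A) = 0 := by
  have := (EuclideanSpace.proj (𝕜 := ℝ) i).integral_comp_comm
    (μ := multivariateGaussian 0 A) (φ := id) IsGaussian.integrable_id
  simpa [integral_id_multivariateGaussian'] using this

lemma integrable_mul_eval_multivariateGaussian (A : Matrix ι ι ℝ) (i j : ι) :
    Integrable (fun y : EuclideanSpace ℝ ι => y i * y j) (multivariateGaussian 0 A) := by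
  refine (integrable_sum_abs_pow A 2).mono (by fun_prop) (ae_of_all _ fun y => ?_)
  have h (i : ι) : |y i| ≤ ∑ j, |y j| := Finset.single_le_sum (f := fun j => |y j|)
    (fun j _ => abs_nonneg _) (Finset.mem_univ i)
  rw [Real.norm_eq_abs, Real.norm_eq_abs, abs_mul, pow_two]
  refine le_trans ?_ (le_abs_self _)
  gcongr <;> exact h _

lemma integral_mul_eval_multivariateGaussian {A : Matrix ι ι ℝ} (hA : A.PosSemidef) (i j : ι) :
    ∫ y : EuclideanSpace ℝ ι, y i * y j ∂(multivariateGaussian 0 A) = A i j := by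
  rw [← covariance_eval_multivariateGaussian (μ := 0) hA i j, covariance]
  simp [integral_eval_multivariateGaussian]

namespace IsSmoothPenalty

variable {ψ ψ₁ ψ₂ ψ₃ : ℝ → ℝ} {K : ℝ}

/-- The second order expansion of `s ↦ E F(w + s X)` for `F = exp (-∑ ψ)` and a centered Gaussian
vector `X`. -/
lemma abs_integral_exp_sub_le (h : IsSmoothPenalty ψ ψ₁ ψ₂ ψ₃ K) {A : Matrix ι ι ℝ}
    (hA : A.PosSemidef) (w : EuclideanSpace ℝ ι) {s : ℝ} (hs : 0 ≤ s) :
    |∫ y, Real.exp (-∑ i, ψ (w i + s * y i)) ∂(multivariateGaussian 0 A)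
        - Real.exp (-∑ i, ψ (w i))
        - (∑ i, ∑ j, ψ₁ (w i) * ψ₁ (w j) * A i j - ∑ i, ψ₂ (w i) * A i i)
          * Real.exp (-∑ i, ψ (w i)) * (s ^ 2 / 2)|
      ≤ (3 * K ^ 2 + K ^ 3 + K)
        * (∫ y, (∑ i, |y i|) ^ 3 ∂(multivariateGaussian 0 A)) * s ^ 3 := by
  set μ := multivariateGaussian 0 A
  set E := Real.exp (-∑ i, ψ (w i))
  have i₁ : Integrable (fun y : EuclideanSpace ℝ ι => ∑ i, ψ₁ (w i) * y i) μ :=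
    integrable_finsetSum _ fun i _ => (integrable_eval_multivariateGaussian A i).const_mul _
  have i₂ : Integrable (fun y : EuclideanSpace ℝ ι =>
      ∑ i, ∑ j, ψ₁ (w i) * ψ₁ (w j) * (y i * y j)) μ :=
    integrable_finsetSum _ fun i _ => integrable_finsetSum _ fun j _ =>
      (integrable_mul_eval_multivariateGaussian A i j).const_mul _
  have i₃ : Integrable (fun y : EuclideanSpace ℝ ι => ∑ i, ψ₂ (w i) * (y i * y i)) μ :=
    integrable_finsetSum _ fun i _ =>
      (integrable_mul_eval_multivariateGaussian A i i).const_mul _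
  have e₁ : ∫ y : EuclideanSpace ℝ ι, ∑ i, ψ₁ (w i) * y i ∂μ = 0 := by
    rw [integral_finsetSum _ fun i _ => (integrable_eval_multivariateGaussian A i).const_mul _]
    simp [integral_const_mul, integral_eval_multivariateGaussian]
  have e₂ : ∫ y : EuclideanSpace ℝ ι, ∑ i, ∑ j, ψ₁ (w i) * ψ₁ (w j) * (y i * y j) ∂μ
      = ∑ i, ∑ j, ψ₁ (w i) * ψ₁ (w j) * A i j := by
    rw [integral_finsetSum _ fun i _ => integrable_finsetSum _ fun j _ =>
      (integrable_mul_eval_multivariateGaussian A i j).const_mul _]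
    refine Finset.sum_congr rfl fun i _ => ?_
    rw [integral_finsetSum _ fun j _ =>
      (integrable_mul_eval_multivariateGaussian A i j).const_mul _]
    simp [integral_const_mul, integral_mul_eval_multivariateGaussian hA]
  have e₃ : ∫ y : EuclideanSpace ℝ ι, ∑ i, ψ₂ (w i) * (y i * y i) ∂μ
      = ∑ i, ψ₂ (w i) * A i i := by
    rw [integral_finsetSum _ fun i _ =>
      (integrable_mul_eval_multivariateGaussian A i i).const_mul _]
    simp [integral_const_mul, integral_mul_eval_multivariateGaussian hA]
  have i₀ := h.integrable_exp (μ := μ) w s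
  have j₀ : Integrable (fun y : EuclideanSpace ℝ ι =>
      Real.exp (-∑ i, ψ (w i + s * y i)) - E) μ := i₀.sub (integrable_const E)
  have j₁ : Integrable (fun y : EuclideanSpace ℝ ι =>
      (∑ i, ∑ j, ψ₁ (w i) * ψ₁ (w j) * (y i * y j)) - ∑ i, ψ₂ (w i) * (y i * y i)) μ := i₂.sub i₃
  have j₂ : Integrable (fun y : EuclideanSpace ℝ ι =>
      Real.exp (-∑ i, ψ (w i + s * y i)) - E + (∑ i, ψ₁ (w i) * y i) * (E * s)) μ :=
    j₀.add (i₁.mul_const _)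
  have key : ∫ y, (Real.exp (-∑ i, ψ (w i + s * y i)) - E
        + (∑ i, ψ₁ (w i) * y i) * (E * s)
        - ((∑ i, ∑ j, ψ₁ (w i) * ψ₁ (w j) * (y i * y j)) - ∑ i, ψ₂ (w i) * (y i * y i))
          * (E * (s ^ 2 / 2))) ∂μ
      = ∫ y, Real.exp (-∑ i, ψ (w i + s * y i)) ∂μ - E
        - (∑ i, ∑ j, ψ₁ (w i) * ψ₁ (w j) * A i j - ∑ i, ψ₂ (w i) * A i i) * E * (s ^ 2 / 2) := by
    rw [integral_sub j₂ (j₁.mul_const _),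
      integral_add j₀ (i₁.mul_const _),
      integral_sub i₀ (integrable_const E), integral_mul_const, integral_mul_const,
      integral_sub i₂ i₃, e₁, e₂, e₃]
    simp
    ring
  rw [← key, mul_assoc, mul_comm (∫ y, (∑ i, |y i|) ^ 3 ∂μ), ← mul_assoc,
    ← integral_const_mul, ← Real.norm_eq_abs]
  refine norm_integral_le_of_norm_le ((integrable_sum_abs_pow A 3).const_mul _)
    (ae_of_all _ fun y => ?_)
  have := h.abs_taylor_exp_le w y hs
  rw [Real.norm_eq_abs]
  convert this using 1
  · congr 1
    have : ∑ i, ∑ j, ψ₁ (w i) * ψ₁ (w j) * (y i * y j) = (∑ i, ψ₁ (w i) * y i) ^ 2 := by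
      rw [pow_two, Finset.sum_mul_sum]
      exact Finset.sum_congr rfl fun i _ => Finset.sum_congr rfl fun j _ => by ring
    rw [this]
    simp only [pow_two]
    ring
  · ring

/-- A Gaussian vector with covariance `W + δ A` is `w + √δ y` with `w`, `y` independent of
covariances `W`, `A`. -/
lemma integral_exp_conv (h : IsSmoothPenalty ψ ψ₁ ψ₂ ψ₃ K) {W A : Matrix ι ι ℝ}
    (hW : W.PosSemidef) (hA : A.PosSemidef) {δ : ℝ} (hδ : 0 ≤ δ) :
    ∫ y, Real.exp (-∑ i, ψ (y i)) ∂(multivariateGaussian 0 (W + δ • A))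
      = ∫ w, ∫ y, Real.exp (-∑ i, ψ (w i + √δ * y i)) ∂(multivariateGaussian 0 A)
        ∂(multivariateGaussian 0 W) := by
  have hc := h.continuous
  rw [← multivariateGaussian_conv hW (hA.smul hδ), integral_conv]
  · refine integral_congr_ae (ae_of_all _ fun w => ?_)
    simp only
    rw [← multivariateGaussian_map_sqrt_smul hA hδ, integral_map (by fun_prop) (by fun_prop)]
    simp
  · simpa using h.integrable_exp (μ := (multivariateGaussian 0 W).conv
      (multivariateGaussian 0 (δ • A))) 0 1

/-- One replacement of `δ A` by `δ B`. In the second-order expansion around a fixed `w`, the `ψ₂`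
terms see only the common diagonal, and the coefficients `ψ₁ (w i) ψ₁ (w j)` are nonnegative, so the
larger covariances can only help. The cost is the cubic remainder with `s = √δ`. -/
lemma integral_exp_step (h : IsSmoothPenalty ψ ψ₁ ψ₂ ψ₃ K) {W A B : Matrix ι ι ℝ}
    (hW : W.PosSemidef) (hA : A.PosSemidef) (hB : B.PosSemidef)
    (hd : ∀ i, A i i = B i i) (hAB : ∀ i j, A i j ≤ B i j) {δ : ℝ} (hδ : 0 ≤ δ) :
    ∫ y, Real.exp (-∑ i, ψ (y i)) ∂(multivariateGaussian 0 (W + δ • A))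
      ≤ ∫ y, Real.exp (-∑ i, ψ (y i)) ∂(multivariateGaussian 0 (W + δ • B))
        + (3 * K ^ 2 + K ^ 3 + K) * (∫ y, (∑ i, |y i|) ^ 3 ∂(multivariateGaussian 0 A)
          + ∫ y, (∑ i, |y i|) ^ 3 ∂(multivariateGaussian 0 B)) * √δ ^ 3 := by
  have hc := h.continuous
  rw [h.integral_exp_conv hW hA hδ, h.integral_exp_conv hW hB hδ]
  have hint : ∀ C : Matrix ι ι ℝ, Integrable (fun w : EuclideanSpace ℝ ι =>
      ∫ y, Real.exp (-∑ i, ψ (w i + √δ * y i)) ∂(multivariateGaussian 0 C))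
      (multivariateGaussian 0 W) := by
    intro C
    have := h.integrable_exp (μ := (multivariateGaussian 0 W)) 0 1
    refine (integrable_const (1 : ℝ)).mono ?_ (ae_of_all _ fun w => ?_)
    · refine StronglyMeasurable.aestronglyMeasurable ?_
      refine StronglyMeasurable.integral_prod_right (f := fun (w y : EuclideanSpace ℝ ι) =>
        Real.exp (-∑ i, ψ (w i + √δ * y i))) ?_
      refine Continuous.stronglyMeasurable ?_
      simp only [Function.uncurry_def]
      fun_prop
    · refine (norm_integral_le_of_norm_le_const (ae_of_all _ fun y : EuclideanSpace ℝ ι =>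
        h.exp_neg_sum_mem (fun i => w i + √δ * y i))).trans ?_
      simp
  rw [← sub_le_iff_le_add', ← integral_sub (hint A) (hint B)]
  refine (integral_mono ((hint A).sub (hint B)) (integrable_const
    ((3 * K ^ 2 + K ^ 3 + K) * (∫ y, (∑ i, |y i|) ^ 3 ∂(multivariateGaussian 0 A)
          + ∫ y, (∑ i, |y i|) ^ 3 ∂(multivariateGaussian 0 B)) * √δ ^ 3))
    fun w => ?_).trans (by simp)
  simp only [Pi.sub_apply]
  have hA' := abs_le.1 (h.abs_integral_exp_sub_le hA w (Real.sqrt_nonneg δ))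
  have hB' := abs_le.1 (h.abs_integral_exp_sub_le hB w (Real.sqrt_nonneg δ))
  have hcmp : (∑ i, ∑ j, ψ₁ (w i) * ψ₁ (w j) * A i j - ∑ i, ψ₂ (w i) * A i i)
          * Real.exp (-∑ i, ψ (w i)) * (√δ ^ 2 / 2)
      ≤ (∑ i, ∑ j, ψ₁ (w i) * ψ₁ (w j) * B i j - ∑ i, ψ₂ (w i) * B i i)
          * Real.exp (-∑ i, ψ (w i)) * (√δ ^ 2 / 2) := by
    simp only [hd]
    gcongr with i _ j _
    · exact mul_nonneg (h.deriv_nonneg _) (h.deriv_nonneg _)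
    · exact hAB i j
  rw [mul_add, add_mul]
  linarith [hA'.2, hB'.1]

/-- Slepian's inequality for smoothed indicators, by Lindeberg's interpolation. -/
lemma integral_exp_le (h : IsSmoothPenalty ψ ψ₁ ψ₂ ψ₃ K) {A B : Matrix ι ι ℝ}
    (hA : A.PosSemidef) (hB : B.PosSemidef)
    (hd : ∀ i, A i i = B i i) (hAB : ∀ i j, A i j ≤ B i j) :
    ∫ y, Real.exp (-∑ i, ψ (y i)) ∂(multivariateGaussian 0 A)
      ≤ ∫ y, Real.exp (-∑ i, ψ (y i)) ∂(multivariateGaussian 0 B) := by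
  set C := (3 * K ^ 2 + K ^ 3 + K) * (∫ y, (∑ i, |y i|) ^ 3 ∂(multivariateGaussian 0 A)
          + ∫ y, (∑ i, |y i|) ^ 3 ∂(multivariateGaussian 0 B))
  have main : ∀ n : ℕ, n ≠ 0 → ∫ y, Real.exp (-∑ i, ψ (y i)) ∂(multivariateGaussian 0 A)
      ≤ ∫ y, Real.exp (-∑ i, ψ (y i)) ∂(multivariateGaussian 0 B) + C * √((n : ℝ)⁻¹) := by
    intro n hn
    have hn' : (0 : ℝ) < n := by positivity
    set δ : ℝ := (n : ℝ)⁻¹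
    have hδ : 0 ≤ δ := by positivity
    -- The segment from `A` to `B` in `n` equal steps. Steps `k` and `k + 1` share the part with
    -- weights `n - k - 1` and `k`, and the `n` errors `C δ^(3/2)` add up to `C √δ`, which tends to
    -- zero.
    set S : ℕ → Matrix ι ι ℝ := fun k => ((n - k : ℝ) * δ) • A + ((k : ℝ) * δ) • B
    have step : ∀ k < n, ∫ y, Real.exp (-∑ i, ψ (y i)) ∂(multivariateGaussian 0 (S k))
      ≤ ∫ y, Real.exp (-∑ i, ψ (y i)) ∂(multivariateGaussian 0 (S (k + 1))) + C * √δ ^ 3 := by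
      intro k hk
      have hk' : (k : ℝ) + 1 ≤ n := by exact_mod_cast hk
      have hW : (((n - (k + 1) : ℝ) * δ) • A + ((k : ℝ) * δ) • B).PosSemidef :=
        (hA.smul (mul_nonneg (by linarith) hδ)).add (hB.smul (by positivity))
      have e₁ : S k = (((n - (k + 1) : ℝ) * δ) • A + ((k : ℝ) * δ) • B) + δ • A := by
        simp only [S]; module
      have e₂ : S (k + 1) = (((n - (k + 1) : ℝ) * δ) • A + ((k : ℝ) * δ) • B) + δ • B := by
        simp only [S]; push_cast; module
      rw [e₁, e₂]
      exact h.integral_exp_step hW hA hB hd hAB hδ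
    have ind : ∀ k ≤ n, ∫ y, Real.exp (-∑ i, ψ (y i)) ∂(multivariateGaussian 0 (S 0))
      ≤ ∫ y, Real.exp (-∑ i, ψ (y i)) ∂(multivariateGaussian 0 (S k)) + k * (C * √δ ^ 3) := by
      intro k
      induction k with
      | zero => simp
      | succ k ih =>
        intro hk
        have := ih (by omega)
        have := step k (by omega)
        push_cast
        linarith
    have := ind n le_rfl
    have h0 : S 0 = A := by simp [S, δ, hn]
    have h1 : S n = B := by simp [S, δ, hn]
    rw [h0, h1] at this
    refine this.trans (le_of_eq ?_)
    congr 1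
    have : √δ ^ 3 = δ * √δ := by rw [pow_succ, Real.sq_sqrt hδ]
    rw [this]
    simp only [δ]
    field_simp
  have lim : Tendsto (fun n : ℕ => ∫ y, Real.exp (-∑ i, ψ (y i)) ∂(multivariateGaussian 0 B)
      + C * √((n : ℝ)⁻¹)) atTop
      (𝓝 (∫ y, Real.exp (-∑ i, ψ (y i)) ∂(multivariateGaussian 0 B) + C * √0)) :=
    ((tendsto_inv_atTop_nhds_zero_nat (𝕜 := ℝ)).sqrt.const_mul C).const_add _
  rw [Real.sqrt_zero, mul_zero, add_zero] at lim
  exact ge_of_tendsto lim (by filter_upwards [eventually_ne_atTop 0] with n hn using main n hn)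

/-- Large multiples sharpen the penalty: `exp (-m ∑ ψ)` tends to the indicator of the set where
every coordinate is at most `c`. The constant `m K` is harmless because `integral_exp_le` carries no
error term. -/
lemma nsmul (h : IsSmoothPenalty ψ ψ₁ ψ₂ ψ₃ K) (m : ℕ) :
    IsSmoothPenalty (fun x => m * ψ x) (fun x => m * ψ₁ x) (fun x => m * ψ₂ x)
      (fun x => m * ψ₃ x) (m * K) where
  nonneg x := mul_nonneg m.cast_nonneg (h.nonneg x)
  deriv_nonneg x := mul_nonneg m.cast_nonneg (h.deriv_nonneg x)
  hasDerivAt₀ x := (h.hasDerivAt₀ x).const_mul _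
  hasDerivAt₁ x := (h.hasDerivAt₁ x).const_mul _
  hasDerivAt₂ x := (h.hasDerivAt₂ x).const_mul _
  bound₁ x := by rw [abs_mul, Nat.abs_cast]; gcongr; exact h.bound₁ x
  bound₂ x := by rw [abs_mul, Nat.abs_cast]; gcongr; exact h.bound₂ x
  bound₃ x := by rw [abs_mul, Nat.abs_cast]; gcongr; exact h.bound₃ x

end IsSmoothPenalty

/-- **Slepian's inequality**: among centered Gaussian vectors with given variances, the probability
that all coordinates are at most `c` increases with the covariances. -/
theorem slepian {A B : Matrix ι ι ℝ} (hA : A.PosSemidef) (hB : B.PosSemidef)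
    (hd : ∀ i, A i i = B i i) (hAB : ∀ i j, A i j ≤ B i j) (c : ℝ) :
    multivariateGaussian 0 A {y | ∀ i, y i ≤ c} ≤ multivariateGaussian 0 B {y | ∀ i, y i ≤ c} := by
  obtain ⟨ψ, ψ₁, ψ₂, ψ₃, K, h, h0, hpos⟩ := exists_isSmoothPenalty c
  have hms : MeasurableSet {y : EuclideanSpace ℝ ι | ∀ i, y i ≤ c} := by
    rw [ofPred_forall]
    exact MeasurableSet.iInter fun i => measurableSet_le (by fun_prop) measurable_const
  have lim : ∀ S : Matrix ι ι ℝ, Tendsto (fun m : ℕ =>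
      ∫ y, Real.exp (-∑ i, m * ψ (y i)) ∂(multivariateGaussian 0 S)) atTop
      (𝓝 ((multivariateGaussian 0 S).real {y | ∀ i, y i ≤ c})) := by
    intro S
    rw [← integral_indicator_one hms]
    refine tendsto_integral_of_dominated_convergence (fun _ => 1) (fun m => ?_)
      (integrable_const _) (fun m => ae_of_all _ fun y => (h.nsmul m).exp_neg_sum_mem _)
      (ae_of_all _ fun y => ?_)
    · have := h.continuous
      fun_prop
    · by_cases hy : ∀ i, y i ≤ c
      · rw [indicator_of_mem (by exact hy)]
        simp [h0 _ (hy _)]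
      · rw [indicator_of_notMem (by exact hy)]
        obtain ⟨i₀, hi₀⟩ := not_forall.1 hy
        have hp : 0 < ∑ i, ψ (y i) := Finset.sum_pos' (fun i _ => h.nonneg _)
          ⟨i₀, Finset.mem_univ _, hpos _ (not_le.1 hi₀)⟩
        simp_rw [← Finset.mul_sum]
        exact Real.tendsto_exp_neg_atTop_nhds_zero.comp
          (tendsto_natCast_atTop_atTop.atTop_mul_const hp)
  have := le_of_tendsto_of_tendsto' (lim A) (lim B)
    fun m => (h.nsmul m).integral_exp_le hA hB hd hAB
  rwa [measureReal_def, measureReal_def, ENNReal.toReal_le_toReal (measure_ne_top _ _)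
    (measure_ne_top _ _)] at this

end HadamardFBM

namespace HadamardFBM

/-! ### Kolmogorov's continuity criterion -/

section Kolmogorov

variable {Ω : Type*} {mΩ : MeasurableSpace Ω} {P : Measure Ω}

/-- Tonelli in `ℝ≥0∞`: a series with finite expected sum converges almost surely. -/
lemma ae_summable_of_integral_le {f : ℕ → Ω → ℝ} {b : ℕ → ℝ} (h0 : ∀ n ω, 0 ≤ f n ω)
    (hf : ∀ n, Integrable (f n) P) (hb : ∀ n, ∫ ω, f n ω ∂P ≤ b n) (hs : Summable b) :
    (∀ᵐ ω ∂P, Summable fun n => f n ω) ∧ Integrable (fun ω => ∑' n, f n ω) P := by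
  have hm (n : ℕ) : AEMeasurable (fun ω => ENNReal.ofReal (f n ω)) P :=
    (hf n).aemeasurable.ennreal_ofReal
  have hfin : ∫⁻ ω, ∑' n, ENNReal.ofReal (f n ω) ∂P ≠ ∞ := by
    rw [lintegral_tsum hm]
    refine ne_top_of_le_ne_top hs.tsum_ofReal_ne_top (ENNReal.tsum_le_tsum fun n => ?_)
    rw [← ofReal_integral_eq_lintegral_ofReal (hf n) (ae_of_all _ (h0 n))]
    exact ENNReal.ofReal_le_ofReal (hb n)
  have hae : ∀ᵐ ω ∂P, Summable fun n => f n ω := by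
    filter_upwards [ae_lt_top' (AEMeasurable.tsum hm) hfin] with ω hω
    have := ENNReal.summable_toReal hω.ne
    simpa [ENNReal.toReal_ofReal (h0 _ _)] using this
  refine ⟨hae, ?_⟩
  have key : (fun ω => ∑' n, f n ω)
      =ᵐ[P] fun ω => (∑' n, ENNReal.ofReal (f n ω)).toReal := by
    filter_upwards [hae] with ω hω
    rw [← ENNReal.ofReal_tsum_of_nonneg (fun n => h0 n ω) hω,
      ENNReal.toReal_ofReal (tsum_nonneg fun n => h0 n ω)]
  exact (integrable_toReal_of_lintegral_ne_top (AEMeasurable.tsum hm) hfin).congr key.symm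

/-- The largest dyadic of level `n` below `t`. -/
noncomputable def dyadicFloor (n : ℕ) (t : ℝ≥0) : ℝ≥0 := ⌊t * 2 ^ n⌋₊ / 2 ^ n

lemma dyadicFloor_le (n : ℕ) (t : ℝ≥0) : dyadicFloor n t ≤ t := by
  rw [dyadicFloor, div_le_iff₀ (by positivity)]
  exact Nat.floor_le zero_le

lemma sub_dyadicFloor_le (n : ℕ) (t : ℝ≥0) : (t : ℝ) - dyadicFloor n t ≤ (1 / 2) ^ n := by
  have h : t * 2 ^ n < ⌊t * 2 ^ n⌋₊ + 1 := Nat.lt_floor_add_one _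
  have h' : (t : ℝ) * 2 ^ n < ⌊t * 2 ^ n⌋₊ + 1 := by exact_mod_cast h
  rw [dyadicFloor]
  push_cast
  rw [one_div, inv_pow, sub_le_iff_le_add, ← one_div, ← add_div, le_div_iff₀ (by positivity)]
  linarith

/-- Bounds the increments over the dyadic intervals of level `n` in `[0, N]`, for `r ^ p = 1 / 2`. -/
noncomputable def dyadicModulus (X : ℝ≥0 → Ω → ℝ) (p : ℕ) (r : ℝ) (N n : ℕ) (ω : Ω) : ℝ :=
  r ^ n + r ^ n * 2 ^ n * ∑ k ∈ Finset.range (N * 2 ^ n),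
    |X (((k + 1 : ℕ) : ℝ≥0) / 2 ^ n) ω - X ((k : ℝ≥0) / 2 ^ n) ω| ^ p

variable {X : ℝ≥0 → Ω → ℝ} {p : ℕ} {r : ℝ}

lemma dyadicModulus_nonneg (hr : 0 < r) (N n : ℕ) (ω : Ω) : 0 ≤ dyadicModulus X p r N n ω := by
  unfold dyadicModulus
  have : 0 ≤ ∑ k ∈ Finset.range (N * 2 ^ n),
    |X (((k + 1 : ℕ) : ℝ≥0) / 2 ^ n) ω - X ((k : ℝ≥0) / 2 ^ n) ω| ^ p :=
    Finset.sum_nonneg fun k _ => by positivity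
  positivity

/-- For `u = d / r ^ n ≥ 0` one has `u ≤ 1 + u ^ p`, and `r ^ (p n) = 2 ^ (-n)`. Summing over all
intervals bounds the largest increment without taking a `p`-th root, so expectations can be taken
termwise. -/
lemma abs_sub_le_dyadicModulus (hp : p ≠ 0) (hr : 0 < r) (hrp : r ^ p = 1 / 2) {N n k : ℕ}
    (hk : k < N * 2 ^ n) (ω : Ω) :
    |X (((k + 1 : ℕ) : ℝ≥0) / 2 ^ n) ω - X ((k : ℝ≥0) / 2 ^ n) ω| ≤ dyadicModulus X p r N n ω := by
  set d : ℕ → ℝ := fun k => |X (((k + 1 : ℕ) : ℝ≥0) / 2 ^ n) ω - X ((k : ℝ≥0) / 2 ^ n) ω|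
  have hd : ∀ k, 0 ≤ d k := fun k => abs_nonneg _
  have h1 : d k ≤ r ^ n + r ^ n * 2 ^ n * d k ^ p := by
    have hrn : 0 < r ^ n := by positivity
    rcases le_total (d k) (r ^ n) with h | h
    · have := hd k
      exact h.trans (le_add_of_nonneg_right (by positivity))
    · have hu : 1 ≤ d k / r ^ n := (one_le_div hrn).2 h
      have hup : d k / r ^ n ≤ (d k / r ^ n) ^ p := le_self_pow₀ hu hp
      have e : (d k / r ^ n) ^ p = 2 ^ n * d k ^ p := by
        rw [div_pow, ← pow_mul, mul_comm n p, pow_mul, hrp, one_div, inv_pow, div_inv_eq_mul,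
          mul_comm]
      rw [e, div_le_iff₀ hrn] at hup
      linarith
  refine h1.trans ?_
  unfold dyadicModulus
  gcongr
  exact Finset.single_le_sum (f := fun k => d k ^ p) (fun k _ => pow_nonneg (hd k) _)
    (Finset.mem_range.2 hk)

lemma floor_mul_two_pow_succ (t : ℝ≥0) (n : ℕ) :
    ⌊t * 2 ^ (n + 1)⌋₊ = 2 * ⌊t * 2 ^ n⌋₊ ∨ ⌊t * 2 ^ (n + 1)⌋₊ = 2 * ⌊t * 2 ^ n⌋₊ + 1 := by
  have h1 : (⌊t * 2 ^ n⌋₊ : ℝ≥0) ≤ t * 2 ^ n := Nat.floor_le zero_le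
  have h2 : t * 2 ^ n < ⌊t * 2 ^ n⌋₊ + 1 := Nat.lt_floor_add_one _
  have e : t * 2 ^ (n + 1) = 2 * (t * 2 ^ n) := by ring
  rw [e]
  have h3 : 2 * ⌊t * 2 ^ n⌋₊ ≤ ⌊2 * (t * 2 ^ n)⌋₊ := by
    apply Nat.le_floor
    push_cast
    gcongr
  have h4 : ⌊2 * (t * 2 ^ n)⌋₊ < 2 * ⌊t * 2 ^ n⌋₊ + 2 := by
    rw [Nat.floor_lt zero_le]
    push_cast
    calc 2 * (t * 2 ^ n) < 2 * (⌊t * 2 ^ n⌋₊ + 1) := by gcongr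
      _ = _ := by ring
  omega

/-- The floors of `t` at consecutive levels coincide or are neighbours on the finer grid. -/
lemma abs_dyadicFloor_succ_sub_le (hp : p ≠ 0) (hr : 0 < r) (hrp : r ^ p = 1 / 2) {N : ℕ}
    {t : ℝ≥0} (ht : t < N) (n : ℕ) (ω : Ω) :
    |X (dyadicFloor n t) ω - X (dyadicFloor (n + 1) t) ω| ≤ dyadicModulus X p r N (n + 1) ω := by
  set m := ⌊t * 2 ^ n⌋₊ with hm
  have e : dyadicFloor n t = ((2 * m : ℕ) : ℝ≥0) / 2 ^ (n + 1) := by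
    rw [dyadicFloor, ← hm, pow_succ]
    push_cast
    field_simp
  rcases floor_mul_two_pow_succ t n with h | h
  · have e' : dyadicFloor (n + 1) t = ((2 * m : ℕ) : ℝ≥0) / 2 ^ (n + 1) := by
      rw [dyadicFloor, h]
    rw [e, e', sub_self, abs_zero]
    exact dyadicModulus_nonneg hr _ _ _
  · have e' : dyadicFloor (n + 1) t = ((2 * m + 1 : ℕ) : ℝ≥0) / 2 ^ (n + 1) := by
      rw [dyadicFloor, h]
    rw [e, e', abs_sub_comm]
    refine abs_sub_le_dyadicModulus hp hr hrp ?_ ω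
    have h1 : ((2 * m + 1 : ℕ) : ℝ≥0) ≤ t * 2 ^ (n + 1) := by
      rw [← h]; exact Nat.floor_le zero_le
    have h2 : ((2 * m + 1 : ℕ) : ℝ≥0) < ((N * 2 ^ (n + 1) : ℕ) : ℝ≥0) := by
      refine h1.trans_lt ?_
      push_cast
      gcongr
    have := Nat.cast_lt.1 h2
    omega

lemma abs_dyadicFloor_sub_le (hp : p ≠ 0) (hr : 0 < r) (hrp : r ^ p = 1 / 2) {N : ℕ}
    {s t : ℝ≥0} (hst : s ≤ t) (ht : t < N) {n : ℕ} (hn : (t : ℝ) - s ≤ (1 / 2) ^ n) (ω : Ω) :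
    |X (dyadicFloor n s) ω - X (dyadicFloor n t) ω| ≤ dyadicModulus X p r N n ω := by
  have h1 : ⌊s * 2 ^ n⌋₊ ≤ ⌊t * 2 ^ n⌋₊ := Nat.floor_le_floor (by gcongr)
  have h2 : ⌊t * 2 ^ n⌋₊ ≤ ⌊s * 2 ^ n⌋₊ + 1 := by
    have : t * 2 ^ n ≤ s * 2 ^ n + 1 := by
      have : ((t : ℝ) - s) * 2 ^ n ≤ 1 := by
        calc ((t : ℝ) - s) * 2 ^ n ≤ (1 / 2) ^ n * 2 ^ n := by gcongr
          _ = 1 := by rw [← mul_pow]; norm_num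
      have : (t : ℝ) * 2 ^ n ≤ s * 2 ^ n + 1 := by linarith
      exact_mod_cast this
    calc ⌊t * 2 ^ n⌋₊ ≤ ⌊s * 2 ^ n + 1⌋₊ := Nat.floor_le_floor this
      _ = _ := Nat.floor_add_one zero_le
  rcases (by omega : ⌊t * 2 ^ n⌋₊ = ⌊s * 2 ^ n⌋₊ ∨ ⌊t * 2 ^ n⌋₊ = ⌊s * 2 ^ n⌋₊ + 1) with h | h
  · rw [dyadicFloor, dyadicFloor, h, sub_self, abs_zero]
    exact dyadicModulus_nonneg hr _ _ _
  · rw [dyadicFloor, dyadicFloor, h, abs_sub_comm]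
    refine abs_sub_le_dyadicModulus hp hr hrp ?_ ω
    have h1 : ((⌊s * 2 ^ n⌋₊ + 1 : ℕ) : ℝ≥0) ≤ t * 2 ^ n := by
      rw [← h]; exact Nat.floor_le zero_le
    have h2 : ((⌊s * 2 ^ n⌋₊ + 1 : ℕ) : ℝ≥0) < ((N * 2 ^ n : ℕ) : ℝ≥0) := by
      refine h1.trans_lt ?_
      push_cast
      gcongr
    have := Nat.cast_lt.1 h2
    omega

lemma integrable_dyadicModulus [IsFiniteMeasure P] {C : ℝ≥0 → ℝ}
    (hC : ∀ T, ∀ s ≤ T, ∀ t ≤ T, Integrable (fun ω => |X s ω - X t ω| ^ p) P ∧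
      ∫ ω, |X s ω - X t ω| ^ p ∂P ≤ C T * ((s : ℝ) - t) ^ 2) (N n : ℕ) :
    Integrable (dyadicModulus X p r N n) P := by
  have hle (k m : ℕ) : (k : ℝ≥0) / 2 ^ m ≤ max ((k : ℝ≥0) / 2 ^ m) (((k + 1 : ℕ) : ℝ≥0) / 2 ^ m) :=
    le_max_left _ _
  refine (integrable_const _).add (Integrable.const_mul (integrable_finsetSum _ fun k _ => ?_) _)
  exact (hC _ _ (le_max_right _ _) _ (hle k n)).1

/-- There are `N 2 ^ n` increments, each of `p`-th moment at most `C N 4 ^ (-n)`; the weight `r ^ n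
2 ^ n` leaves `N * C N * r ^ n`, summable in `n`. -/
lemma integral_dyadicModulus_le [IsProbabilityMeasure P] {C : ℝ≥0 → ℝ} (hr : 0 < r)
    (hC : ∀ T, ∀ s ≤ T, ∀ t ≤ T, Integrable (fun ω => |X s ω - X t ω| ^ p) P ∧
      ∫ ω, |X s ω - X t ω| ^ p ∂P ≤ C T * ((s : ℝ) - t) ^ 2) (N n : ℕ) :
    ∫ ω, dyadicModulus X p r N n ω ∂P ≤ (1 + N * C N) * r ^ n := by
  have hb : ∀ k ∈ Finset.range (N * 2 ^ n), ∀ j ≤ k + 1, (j : ℝ≥0) / 2 ^ n ≤ N := by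
    intro k hk j hj
    rw [div_le_iff₀ (by positivity)]
    have : j ≤ N * 2 ^ n := by have := Finset.mem_range.1 hk; omega
    exact_mod_cast this
  have hi : ∀ k ∈ Finset.range (N * 2 ^ n), Integrable (fun ω =>
      |X (((k + 1 : ℕ) : ℝ≥0) / 2 ^ n) ω - X ((k : ℝ≥0) / 2 ^ n) ω| ^ p) P := fun k hk =>
    (hC N _ (hb k hk _ le_rfl) _ (hb k hk k (by omega))).1
  unfold dyadicModulus
  rw [integral_add (integrable_const _) ((integrable_finsetSum _ hi).const_mul _),
    integral_const_mul, integral_finsetSum _ hi]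
  have hsum : ∑ k ∈ Finset.range (N * 2 ^ n), ∫ ω,
      |X (((k + 1 : ℕ) : ℝ≥0) / 2 ^ n) ω - X ((k : ℝ≥0) / 2 ^ n) ω| ^ p ∂P
      ≤ ∑ k ∈ Finset.range (N * 2 ^ n), C N * ((1 / 2) ^ n) ^ 2 := by
    refine Finset.sum_le_sum fun k hk => ?_
    refine (hC N _ (hb k hk _ le_rfl) _ (hb k hk k (by omega))).2.trans (le_of_eq ?_)
    congr 2
    push_cast
    rw [← sub_div, add_sub_cancel_left, one_div, one_div, inv_pow]
  calc _ ≤ r ^ n + r ^ n * 2 ^ n * ∑ k ∈ Finset.range (N * 2 ^ n), C N * ((1 / 2) ^ n) ^ 2 := by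
        simp only [integral_const, probReal_univ, one_smul]
        gcongr
    _ = (1 + N * C N) * r ^ n := by
        simp only [Finset.sum_const, Finset.card_range, nsmul_eq_mul]
        push_cast
        rw [one_div, inv_pow]
        field_simp

/-- **Kolmogorov's continuity criterion** on the half line, with an integrable bound for the
path on bounded intervals. -/
theorem exists_continuous_modification [IsProbabilityMeasure P] (hp : p ≠ 0)
    (hm : ∀ t, Measurable (X t)) (hi : ∀ t, Integrable (X t) P)
    (hX : ∀ T : ℝ≥0, ∃ C : ℝ, ∀ s ≤ T, ∀ t ≤ T, Integrable (fun ω => |X s ω - X t ω| ^ p) P ∧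
      ∫ ω, |X s ω - X t ω| ^ p ∂P ≤ C * ((s : ℝ) - t) ^ 2) :
    ∃ Z : ℝ≥0 → Ω → ℝ, (∀ t, Measurable (Z t)) ∧ (∀ ω, Continuous fun t => Z t ω) ∧
      (∀ t, Z t =ᵐ[P] X t) ∧
      ∀ T : ℝ≥0, ∃ g : Ω → ℝ, Integrable g P ∧ ∀ᵐ ω ∂P, ∀ s ≤ T, |Z s ω| ≤ g ω := by
  choose C hC using hX
  obtain ⟨r, hr, hr1, hrp⟩ : ∃ r : ℝ, 0 < r ∧ r < 1 ∧ r ^ p = 1 / 2 := by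
    refine ⟨(1 / 2) ^ (1 / (p : ℝ)), by positivity, ?_, ?_⟩
    · exact Real.rpow_lt_one (by norm_num) (by norm_num) (by positivity)
    · rw [← Real.rpow_natCast, ← Real.rpow_mul (by norm_num), one_div_mul_cancel (by positivity),
        Real.rpow_one]
  set S : ℕ → ℕ → Ω → ℝ := dyadicModulus X p r with hS
  have hS0 : ∀ N n ω, 0 ≤ S N n ω := fun N n ω => dyadicModulus_nonneg hr N n ω
  have hSm : ∀ N n, Measurable (S N n) := fun N n => by
    simp only [hS]; unfold dyadicModulus; fun_prop
  have hsum (N : ℕ) := ae_summable_of_integral_le (f := S N) (b := fun n => (1 + N * C N) * r ^ n)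
    (hS0 N) (integrable_dyadicModulus hC N) (integral_dyadicModulus_le hr hC N)
    ((summable_geometric_of_lt_one hr.le hr1).mul_left _)
  -- The good event is written in `ℝ≥0∞` so as to be measurable. Setting the approximations to zero
  -- off it makes every path of the limit continuous, not just almost every one.
  set G : Set Ω := {ω | ∀ N, ∑' n, ENNReal.ofReal (S N n ω) ≠ ∞} with hG
  have hGm : MeasurableSet G := by
    rw [hG, ofPred_forall]
    refine MeasurableSet.iInter fun N => ?_
    have : Measurable fun ω => ∑' n, ENNReal.ofReal (S N n ω) := by fun_prop
    exact (this (measurableSet_singleton ∞)).compl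
  have hGs : ∀ ω ∈ G, ∀ N, Summable fun n => S N n ω := by
    intro ω hω N
    have := ENNReal.summable_toReal (hω N)
    simpa [ENNReal.toReal_ofReal (hS0 _ _ _)] using this
  have hGae : ∀ᵐ ω ∂P, ω ∈ G := by
    filter_upwards [ae_all_iff.2 fun N => (hsum N).1] with ω hω N
    exact (hω N).tsum_ofReal_ne_top
  set Y : ℕ → ℝ≥0 → Ω → ℝ := fun n t => G.indicator (X (dyadicFloor n t)) with hY
  have hYm : ∀ n t, Measurable (Y n t) := fun n t => (hm _).indicator hGm
  have hstep : ∀ {N : ℕ} {t : ℝ≥0}, t < N → ∀ n, ∀ ω ∈ G,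
      dist (Y n t ω) (Y (n + 1) t ω) ≤ S N (n + 1) ω := by
    intro N t ht n ω hω
    simp only [hY, indicator_of_mem hω, Real.dist_eq]
    exact abs_dyadicFloor_succ_sub_le hp hr hrp ht n ω
  have hsum1 : ∀ N, ∀ ω ∈ G, Summable fun n => S N (n + 1) ω := fun N ω hω =>
    (summable_nat_add_iff 1).2 (hGs ω hω N)
  have hex : ∀ t ω, ∃ z, Tendsto (fun n => Y n t ω) atTop (𝓝 z) := by
    intro t ω
    by_cases hω : ω ∈ G
    · obtain ⟨N, hN⟩ := exists_nat_gt t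
      exact cauchySeq_tendsto_of_complete
        (cauchySeq_of_dist_le_of_summable _ (fun n => hstep hN n ω hω) (hsum1 N ω hω))
    · exact ⟨0, by simp [hY, indicator_of_notMem hω]⟩
  choose Z hZ using hex
  have hdist : ∀ {N : ℕ} {t : ℝ≥0}, t < N → ∀ n, ∀ ω ∈ G,
      |Y n t ω - Z t ω| ≤ ∑' m, S N (n + m + 1) ω := fun {N t} ht n ω hω =>
    dist_le_tsum_of_dist_le_of_tendsto _ (fun n => hstep ht n ω hω) (hsum1 N ω hω) (hZ t ω) n
  refine ⟨Z, fun t => measurable_of_tendsto_metrizable (fun n => hYm n t)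
    (tendsto_pi_nhds.2 fun ω => hZ t ω), fun ω => ?_, fun t => ?_, fun T => ?_⟩
  · by_cases hω : ω ∈ G
    swap
    · have : (fun t => Z t ω) = fun _ => 0 := by
        funext t
        exact tendsto_nhds_unique (hZ t ω) (by simp [hY, indicator_of_notMem hω])
      rw [this]
      exact continuous_const
    rw [Metric.continuous_iff]
    intro t ε hε
    obtain ⟨N, hN⟩ := exists_nat_gt (t + 1)
    have h1 : Tendsto (fun n => ∑' m, S N (n + m + 1) ω) atTop (𝓝 0) := by
      have := tendsto_sum_nat_add fun n => S N (n + 1) ω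
      refine this.congr fun n => tsum_congr fun m => ?_
      rw [add_comm m n]
    have h2 : Tendsto (fun n => S N n ω) atTop (𝓝 0) := (hGs ω hω N).tendsto_atTop_zero
    -- The path at `s` and `t` is compared through the level `n` floors: two tails of the modulus
    -- series and one increment of level `n`.
    have h3 : ∀ᶠ n in atTop, ∑' m, S N (n + m + 1) ω + S N n ω + ∑' m, S N (n + m + 1) ω < ε := by
      refine ((h1.add h2).add h1).eventually_lt_const ?_
      simpa using hε
    obtain ⟨n, hn⟩ := h3.exists
    refine ⟨(1 / 2) ^ n, by positivity, fun s hs => ?_⟩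
    have hs1 : s < N := by
      have h4 : dist s t < 1 := hs.trans_le (pow_le_one₀ (by norm_num) (by norm_num))
      rw [NNReal.dist_eq] at h4
      have h5 : (s : ℝ) < t + 1 := by linarith [(abs_lt.1 h4).2]
      have h6 : s < t + 1 := by exact_mod_cast h5
      exact h6.trans hN
    have ht1 : t < N := (lt_add_one t).trans hN
    have hmid : |Y n s ω - Y n t ω| ≤ S N n ω := by
      simp only [hY, indicator_of_mem hω]
      rw [NNReal.dist_eq] at hs
      rcases le_total s t with h | h
      · exact abs_dyadicFloor_sub_le hp hr hrp h ht1 (by linarith [(abs_lt.1 hs).1]) ω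
      · rw [abs_sub_comm]
        exact abs_dyadicFloor_sub_le hp hr hrp h hs1 (by linarith [(abs_lt.1 hs).2]) ω
    have hd1 := hdist hs1 n ω hω
    have hd2 := hdist ht1 n ω hω
    rw [abs_sub_comm] at hd1
    rw [Real.dist_eq]
    calc |Z s ω - Z t ω| = |(Z s ω - Y n s ω) + (Y n s ω - Y n t ω) + (Y n t ω - Z t ω)| := by
          congr 1; ring
      _ ≤ |Z s ω - Y n s ω| + |Y n s ω - Y n t ω| + |Y n t ω - Z t ω| := abs_add_three _ _ _
      _ < ε := by linarith
  -- At a fixed `t` the `p`-th moments of `X (dyadicFloor n t) - X t` are `O(4 ^ (-n))`, hence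
  -- summable, so these values converge almost surely to `X t`; on the good event they converge to
  -- `Z t` by construction.
  · have hq := ae_summable_of_integral_le (P := P)
      (f := fun n ω => |X (dyadicFloor n t) ω - X t ω| ^ p)
      (b := fun n => |C t| * (1 / 4) ^ n) (fun n ω => by positivity)
      (fun n => (hC t _ (dyadicFloor_le n t) _ le_rfl).1)
      (fun n => by
        refine (hC t _ (dyadicFloor_le n t) _ le_rfl).2.trans ?_
        have h1 := sub_dyadicFloor_le n t
        have h2 : (dyadicFloor n t : ℝ) ≤ t := by exact_mod_cast dyadicFloor_le n t
        have h3 : ((dyadicFloor n t : ℝ) - t) ^ 2 ≤ (1 / 4) ^ n := by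
          calc ((dyadicFloor n t : ℝ) - t) ^ 2 = ((t : ℝ) - dyadicFloor n t) ^ 2 := by ring
            _ ≤ ((1 / 2) ^ n) ^ 2 := by gcongr
            _ = (1 / 4) ^ n := by rw [← pow_mul, mul_comm, pow_mul]; norm_num
        gcongr
        exact le_abs_self _)
      ((summable_geometric_of_lt_one (by norm_num) (by norm_num)).mul_left _)
    filter_upwards [hGae, hq.1] with ω hω hs
    refine tendsto_nhds_unique (hZ t ω) ?_
    simp only [hY, indicator_of_mem hω]
    have h1 := hs.tendsto_atTop_zero
    rw [tendsto_iff_dist_tendsto_zero]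
    have h2 := h1.rpow_const (p := 1 / (p : ℝ)) (Or.inr (by positivity))
    rw [Real.zero_rpow (by positivity)] at h2
    refine h2.congr fun n => ?_
    rw [Real.dist_eq, ← Real.rpow_natCast, ← Real.rpow_mul (abs_nonneg _),
      mul_one_div_cancel (by positivity), Real.rpow_one]
  · obtain ⟨N, hN⟩ := exists_nat_gt T
    -- At level zero the floor of `s` is an integer below `N`; the modulus series controls the rest
    -- of the chain.
    refine ⟨fun ω => ∑ k ∈ Finset.range N, |X k ω| + ∑' n, S N n ω,
      Integrable.add (f := fun ω => ∑ k ∈ Finset.range N, |X k ω|)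
        (integrable_finsetSum _ fun (k : ℕ) _ => (hi k).abs) (hsum N).2, ?_⟩
    filter_upwards [hGae] with ω hω s hs
    have hsN : s < N := hs.trans_lt hN
    have h1 := hdist hsN 0 ω hω
    have h2 : ∑' m, S N (0 + m + 1) ω ≤ ∑' n, S N n ω := by
      rw [(hGs ω hω N).tsum_eq_zero_add]
      simp only [zero_add]
      linarith [hS0 N 0 ω]
    have h3 : |Y 0 s ω| ≤ ∑ k ∈ Finset.range N, |X k ω| := by
      simp only [hY, indicator_of_mem hω]
      have e : dyadicFloor 0 s = (⌊s⌋₊ : ℝ≥0) := by simp [dyadicFloor]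
      rw [e]
      exact Finset.single_le_sum (f := fun k : ℕ => |X k ω|) (fun k _ => abs_nonneg _)
        (Finset.mem_range.2 ((Nat.floor_lt zero_le).2 hsN))
    calc |Z s ω| = |Y 0 s ω - (Y 0 s ω - Z s ω)| := by congr 1; ring
      _ ≤ |Y 0 s ω| + |Y 0 s ω - Z s ω| := abs_sub _ _
      _ ≤ _ := by linarith

end Kolmogorov

end HadamardFBM

namespace HadamardFBM

/-! ### The kernel of the Hadamard fractional Brownian motion -/

lemma hasDerivAt_log_div_rpow {x z : ℝ} (hx : 0 < x) (hz : x < z) (γ : ℝ) :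
    HasDerivAt (fun z => Real.log (z / x) ^ γ) (γ * (Real.log (z / x) ^ (γ - 1) / z)) z := by
  have hz0 : 0 < z := hx.trans hz
  have hlog : 0 < Real.log (z / x) := Real.log_pos ((one_lt_div hx).2 hz)
  have h1 : HasDerivAt (fun z => Real.log (z / x)) (1 / z) z :=
    (((hasDerivAt_id' z).div_const x).log (by positivity)).congr_deriv (by field_simp)
  exact (h1.rpow_const (Or.inl hlog.ne')).congr_deriv (by ring)

lemma integral_log_div_rpow {γ x t : ℝ} (hγ : 0 < γ) (hx : 0 < x) (ht : x < t) :
    ∫ z in Ioo x t, Real.log (z / x) ^ (γ - 1) / z = Real.log (t / x) ^ γ / γ := by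
  have hc : ContinuousOn (fun z => Real.log (z / x) ^ γ / γ) (Icc x t) := by
    refine ContinuousOn.div_const (ContinuousOn.rpow_const (ContinuousOn.log (by fun_prop) ?_)
      fun _ _ => Or.inr hγ.le) _
    intro z hz
    have : 0 < z := hx.trans_le hz.1
    positivity
  have hd : ∀ z ∈ Ioo x t, HasDerivAt (fun z => Real.log (z / x) ^ γ / γ)
      (Real.log (z / x) ^ (γ - 1) / z) z := fun z hz =>
    ((hasDerivAt_log_div_rpow hx hz.1 γ).div_const γ).congr_deriv (by field_simp)
  have hnn : ∀ z ∈ Ioo x t, 0 ≤ Real.log (z / x) ^ (γ - 1) / z := fun z hz => by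
    have h1 : 0 < z := hx.trans hz.1
    have h2 : 0 < Real.log (z / x) := Real.log_pos ((one_lt_div hx).2 hz.1)
    positivity
  -- For `γ < 1` the integrand blows up at `x`; it is integrable as the nonnegative derivative of a
  -- function continuous up to the endpoints.
  have hint : IntervalIntegrable (fun z => Real.log (z / x) ^ (γ - 1) / z) volume x t := by
    rw [intervalIntegrable_iff_integrableOn_Ioc_of_le ht.le]
    exact intervalIntegral.integrableOn_deriv_of_nonneg hc hd hnn
  have := intervalIntegral.integral_eq_sub_of_hasDerivAt_of_le ht.le hc hd hint
  rw [intervalIntegral.integral_of_le ht.le, integral_Ioc_eq_integral_Ioo] at this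
  rw [this, div_self hx.ne', Real.log_one, Real.zero_rpow hγ.ne']
  simp

lemma hadamardIntegral_indicator {γ t : ℝ} (hγ : 0 < γ) (x : ℝ) :
    hadamardIntegral γ (indicator (Ico 0 t) 1) x
      = indicator (Ioo 0 t) (fun x => (Real.Gamma (γ + 1))⁻¹ * Real.log (t / x) ^ γ) x := by
  unfold hadamardIntegral
  split_ifs with hx
  · rcases lt_or_ge x t with ht | ht
    · rw [indicator_of_mem (show x ∈ Ioo 0 t from ⟨hx, ht⟩)]
      have e : ∫ z in Ioi x, Real.log (z / x) ^ (γ - 1) * (Ico 0 t).indicator 1 z / z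
          = ∫ z in Ioo x t, Real.log (z / x) ^ (γ - 1) / z := by
        rw [← integral_indicator measurableSet_Ioi, ← integral_indicator measurableSet_Ioo]
        congr 1
        ext z
        simp only [indicator_apply, mem_Ioi, mem_Ioo, mem_Ico, Pi.one_apply]
        by_cases h1 : x < z
        · have : 0 ≤ z := (hx.trans h1).le
          by_cases h2 : z < t <;> simp [h1, h2, this]
        · simp [h1]
      rw [e, integral_log_div_rpow hγ hx ht, Real.Gamma_add_one hγ.ne', mul_inv]
      ring
    · rw [indicator_of_notMem (fun h => not_lt.2 ht h.2)]
      rw [setIntegral_eq_zero_of_forall_eq_zero, mul_zero]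
      intro z hz
      rw [indicator_of_notMem (fun h => not_lt.2 (ht.trans (le_of_lt hz)) h.2)]
      simp
  · rw [indicator_of_notMem (fun h => hx h.1)]

/-- The explicit form of the kernel, `Γ(α)^(-1/2) (log (t / x))^((α - 1) / 2)` on `(0, t)`. -/
noncomputable def logKernel (α : ℝ) (t : ℝ≥0) : ℝ → ℝ :=
  indicator (Ioo 0 (t : ℝ)) fun x => (√(Real.Gamma α))⁻¹ * Real.log (t / x) ^ ((α - 1) / 2)

lemma hadamardKernel_eq_of_one_lt {α : ℝ} (h1 : 1 < α) (t : ℝ≥0) :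
    hadamardKernel α t = logKernel α t := by
  ext x
  have hg : 0 < Real.Gamma ((α + 1) / 2) := Real.Gamma_pos_of_pos (by linarith)
  rw [hadamardKernel, hadamardOp, if_neg (not_lt.2 h1.le), if_neg h1.ne',
    hadamardIntegral_indicator (by linarith), logKernel, indicator_apply, indicator_apply,
    hadamardConst, show (α - 1) / 2 + 1 = (α + 1) / 2 by ring]
  split_ifs
  · field_simp
  · simp

/-- The order `(1 - α)/2` has integer part zero, so `-x d/dx` acts once on the integral of order `β
= (α + 1)/2`. It maps `log (t/x) ^ β` to `β log (t/x) ^ (β - 1)`, and `Γ(β + 1) = β Γ(β)` cancels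
against the normalizing constant. The points `0` and `t`, where the formula is not local, are
discarded. -/
lemma hadamardKernel_ae_eq_of_lt_one {α : ℝ} (h0 : 0 < α) (h1 : α < 1) (t : ℝ≥0) :
    hadamardKernel α t =ᵐ[volume] logKernel α t := by
  have hne : ∀ a : ℝ, ∀ᵐ x : ℝ, x ≠ a := fun a => by
    simp [ae_iff, measure_singleton]
  filter_upwards [hne t, hne 0] with x hxt hx0
  have hγ : ⌊(1 - α) / 2⌋₊ = 0 := Nat.floor_eq_zero.2 (by linarith)
  have hδ : 0 < 1 - (1 - α) / 2 := by linarith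
  have hg : 0 < Real.Gamma ((α + 1) / 2) := Real.Gamma_pos_of_pos (by linarith)
  rw [hadamardKernel, hadamardOp, if_pos h1, hadamardDeriv, hγ]
  simp only [zero_add, Function.iterate_one, Nat.cast_one]
  rw [funext (hadamardIntegral_indicator (t := (t : ℝ)) hδ), logKernel]
  by_cases hx : x ∈ Ioo 0 (t : ℝ)
  · rw [indicator_of_mem hx]
    have hloc : (indicator (Ioo 0 (t : ℝ)) fun x => (Real.Gamma (1 - (1 - α) / 2 + 1))⁻¹
        * Real.log (t / x) ^ (1 - (1 - α) / 2)) =ᶠ[𝓝 x] fun x =>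
          (Real.Gamma (1 - (1 - α) / 2 + 1))⁻¹ * Real.log (t / x) ^ (1 - (1 - α) / 2) := by
      filter_upwards [isOpen_Ioo.mem_nhds hx] with y hy
      rw [indicator_of_mem hy]
    have ht0 : (0 : ℝ) < t := hx.1.trans hx.2
    have hlog : 0 < Real.log (t / x) := Real.log_pos ((one_lt_div hx.1).2 hx.2)
    have hd1 : HasDerivAt (fun x : ℝ => Real.log (t / x)) (-1 / x) x := by
      have := (((hasDerivAt_const x (t : ℝ)).fun_div (hasDerivAt_id' x) hx0).log
        (div_pos ht0 hx.1).ne')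
      exact this.congr_deriv (by field_simp; ring)
    have hd := ((hd1.rpow_const (p := 1 - (1 - α) / 2) (Or.inl hlog.ne')).const_mul
      (Real.Gamma (1 - (1 - α) / 2 + 1))⁻¹)
    rw [hloc.deriv_eq, hd.deriv, Real.Gamma_add_one hδ.ne', hadamardConst,
      show 1 - (1 - α) / 2 = (α + 1) / 2 by ring, show (α + 1) / 2 - 1 = (α - 1) / 2 by ring]
    have : α + 1 ≠ 0 := by linarith
    field_simp
  · rw [indicator_of_notMem hx]
    have hopen : IsOpen ({y : ℝ | y < 0} ∪ {y : ℝ | (t : ℝ) < y}) :=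
      (isOpen_gt' 0).union (isOpen_lt' _)
    have hmem : x ∈ ({y : ℝ | y < 0} ∪ {y : ℝ | (t : ℝ) < y}) := by
      rw [mem_Ioo, not_and_or, not_lt, not_lt] at hx
      rcases hx with hx | hx
      · exact Or.inl (lt_of_le_of_ne hx hx0)
      · exact Or.inr (lt_of_le_of_ne hx hxt.symm)
    have hloc : (indicator (Ioo 0 (t : ℝ)) fun x => (Real.Gamma (1 - (1 - α) / 2 + 1))⁻¹
        * Real.log (t / x) ^ (1 - (1 - α) / 2)) =ᶠ[𝓝 x] fun _ => 0 := by
      filter_upwards [hopen.mem_nhds hmem] with y hy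
      rw [indicator_of_notMem]
      rintro ⟨h2, h3⟩
      rcases hy with hy | hy
      · exact lt_asymm hy h2
      · exact lt_asymm hy h3
    rw [hloc.deriv_eq, deriv_const]
    simp

lemma hadamardKernel_ae_eq {α : ℝ} (hα : α ∈ Ioo (0 : ℝ) 1 ∪ Ioo (1 : ℝ) 2) (t : ℝ≥0) :
    hadamardKernel α t =ᵐ[volume] logKernel α t := by
  rcases hα with h | h
  · exact hadamardKernel_ae_eq_of_lt_one h.1 h.2 t
  · rw [hadamardKernel_eq_of_one_lt h.1]

lemma image_mul_exp_neg {s : ℝ} (hs : 0 < s) :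
    (fun u => s * Real.exp (-u)) '' Ioi 0 = Ioo 0 s := by
  ext x
  constructor
  · rintro ⟨u, hu, rfl⟩
    refine ⟨by positivity, ?_⟩
    have : Real.exp (-u) < 1 := Real.exp_lt_one_iff.2 (by simpa using hu)
    exact mul_lt_of_lt_one_right hs this
  · rintro ⟨h0, h1⟩
    refine ⟨Real.log (s / x), Real.log_pos ((one_lt_div h0).2 h1), ?_⟩
    simp only
    rw [← Real.log_inv, inv_div, Real.exp_log (by positivity)]
    field_simp

/-- The substitution `x = s e^(-u)` gives Euler's integral for `Γ(a)`. -/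
lemma integral_log_rpow {s a : ℝ} (hs : 0 < s) (ha : 0 < a) :
    IntegrableOn (fun x => Real.log (s / x) ^ (a - 1)) (Ioo 0 s) ∧
      ∫ x in Ioo 0 s, Real.log (s / x) ^ (a - 1) = s * Real.Gamma a := by
  have hd : ∀ u ∈ Ioi (0 : ℝ), HasDerivWithinAt (fun u => s * Real.exp (-u))
      (-(s * Real.exp (-u))) (Ioi 0) u := fun u _ =>
    (((hasDerivAt_id' u).fun_neg.exp.const_mul s).congr_deriv (by ring)).hasDerivWithinAt
  have hinj : InjOn (fun u => s * Real.exp (-u)) (Ioi 0) := by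
    intro u _ v _ h
    have := Real.exp_injective (mul_left_cancel₀ hs.ne' h)
    linarith
  have hsimp : ∀ u : ℝ, |-(s * Real.exp (-u))| • Real.log (s / (s * Real.exp (-u))) ^ (a - 1)
      = s * (Real.exp (-u) * u ^ (a - 1)) := by
    intro u
    rw [abs_neg, abs_of_pos (by positivity), smul_eq_mul, ← div_div, div_self hs.ne', one_div,
      ← Real.exp_neg, neg_neg, Real.log_exp, mul_assoc]
  rw [← image_mul_exp_neg hs, integrableOn_image_iff_integrableOn_abs_deriv_smul measurableSet_Ioi
    hd hinj, integral_image_eq_integral_abs_deriv_smul measurableSet_Ioi hd hinj]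
  simp_rw [hsimp]
  refine ⟨(Real.GammaIntegral_convergent ha).const_mul s, ?_⟩
  rw [integral_const_mul, Real.Gamma_eq_integral ha]

/-! ### Covariances of the kernels and their comparison with `min s t`. -/

variable {α : ℝ}

lemma measurable_logKernel (t : ℝ≥0) : Measurable (logKernel α t) :=
  Measurable.indicator (by fun_prop) measurableSet_Ioo

lemma logKernel_mul_of_mem {s t : ℝ≥0} {x : ℝ} (h0 : 0 < α) (hs : x ∈ Ioo 0 (s : ℝ))
    (ht : x ∈ Ioo 0 (t : ℝ)) :
    logKernel α s x * logKernel α t x = (Real.Gamma α)⁻¹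
      * (Real.log (s / x) ^ ((α - 1) / 2) * Real.log (t / x) ^ ((α - 1) / 2)) := by
  rw [logKernel, logKernel, indicator_of_mem hs, indicator_of_mem ht]
  have : (√(Real.Gamma α))⁻¹ * (√(Real.Gamma α))⁻¹ = (Real.Gamma α)⁻¹ := by
    rw [← mul_inv, Real.mul_self_sqrt (Real.Gamma_pos_of_pos h0).le]
  rw [← this]
  ring

lemma logKernel_mul_self (h0 : 0 < α) (t : ℝ≥0) :
    (fun x => logKernel α t x * logKernel α t x)
      = indicator (Ioo 0 (t : ℝ)) fun x => (Real.Gamma α)⁻¹ * Real.log (t / x) ^ (α - 1) := by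
  ext x
  by_cases hx : x ∈ Ioo 0 (t : ℝ)
  · have hlog : 0 < Real.log (t / x) := Real.log_pos ((one_lt_div hx.1).2 hx.2)
    rw [logKernel_mul_of_mem h0 hx hx, indicator_of_mem hx, ← Real.rpow_add hlog]
    ring_nf
  · simp [logKernel, indicator_of_notMem hx]

lemma integral_logKernel_mul_self (h0 : 0 < α) (t : ℝ≥0) :
    Integrable (fun x => logKernel α t x * logKernel α t x) ∧
      ∫ x, logKernel α t x * logKernel α t x = t := by
  rw [logKernel_mul_self h0, integrable_indicator_iff measurableSet_Ioo,
    integral_indicator measurableSet_Ioo]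
  rcases eq_or_ne t 0 with rfl | ht
  · simp
  have ht : (0 : ℝ) < t := by positivity
  have h := integral_log_rpow ht h0
  refine ⟨h.1.const_mul _, ?_⟩
  rw [integral_const_mul, h.2]
  have := Real.Gamma_pos_of_pos h0
  field_simp

lemma memLp_logKernel (h0 : 0 < α) (t : ℝ≥0) : MemLp (logKernel α t) 2 := by
  rw [memLp_two_iff_integrable_sq (measurable_logKernel t).aestronglyMeasurable]
  simpa only [pow_two] using (integral_logKernel_mul_self h0 t).1

/-- The covariance function of the Hadamard fractional Brownian motion. -/
noncomputable def hadamardCov (α : ℝ) (s t : ℝ≥0) : ℝ := ∫ x, logKernel α s x * logKernel α t x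

lemma hadamardCov_self (h0 : 0 < α) (t : ℝ≥0) : hadamardCov α t t = t :=
  (integral_logKernel_mul_self h0 t).2

lemma hadamardCov_comm (s t : ℝ≥0) : hadamardCov α s t = hadamardCov α t s := by
  simp only [hadamardCov, mul_comm]

lemma integrable_logKernel_mul (h0 : 0 < α) (s t : ℝ≥0) :
    Integrable (fun x => logKernel α s x * logKernel α t x) :=
  (memLp_logKernel h0 s).integrable_mul (memLp_logKernel h0 t)

lemma log_div_le_log_div {s t : ℝ≥0} (hst : s ≤ t) {x : ℝ} (hx : x ∈ Ioo 0 (s : ℝ)) :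
    0 < Real.log (s / x) ∧ Real.log (s / x) ≤ Real.log (t / x) ∧ x ∈ Ioo 0 (t : ℝ) := by
  have hst' : (s : ℝ) ≤ t := by exact_mod_cast hst
  have hs : 0 < (s : ℝ) := hx.1.trans hx.2
  refine ⟨Real.log_pos ((one_lt_div hx.1).2 hx.2), ?_, hx.1, hx.2.trans_le hst'⟩
  exact Real.log_le_log (div_pos hs hx.1) (div_le_div_of_nonneg_right hst' hx.1.le)

/-- The bound `s` is the integral of the squared kernel; since `(α - 1)/2 < 0`, the larger logarithm
makes the second factor smaller. -/
lemma hadamardCov_le (h0 : 0 < α) (h1 : α < 1) {s t : ℝ≥0} (hst : s ≤ t) :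
    hadamardCov α s t ≤ s := by
  rw [← hadamardCov_self h0 s]
  refine integral_mono (integrable_logKernel_mul h0 s t) (integrable_logKernel_mul h0 s s)
    fun x => ?_
  by_cases hx : x ∈ Ioo 0 (s : ℝ)
  · obtain ⟨hl, hle, hxt⟩ := log_div_le_log_div hst hx
    simp only
    rw [logKernel_mul_of_mem h0 hx hxt, logKernel_mul_of_mem h0 hx hx]
    have := Real.Gamma_pos_of_pos h0
    gcongr ?_ * (?_ * ?_)
    exact Real.rpow_le_rpow_of_nonpos hl hle (by linarith)
  · simp [logKernel, indicator_of_notMem hx]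

lemma le_hadamardCov (h1 : 1 < α) {s t : ℝ≥0} (hst : s ≤ t) : s ≤ hadamardCov α s t := by
  have h0 : 0 < α := by linarith
  rw [← hadamardCov_self h0 s]
  refine integral_mono (integrable_logKernel_mul h0 s s) (integrable_logKernel_mul h0 s t)
    fun x => ?_
  by_cases hx : x ∈ Ioo 0 (s : ℝ)
  · obtain ⟨hl, hle, hxt⟩ := log_div_le_log_div hst hx
    simp only
    rw [logKernel_mul_of_mem h0 hx hxt, logKernel_mul_of_mem h0 hx hx]
    have := Real.Gamma_pos_of_pos h0
    gcongr
  · simp [logKernel, indicator_of_notMem hx]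

/-- For `v = h/u ≤ 1`: `1 - (1 + v)^(-γ) ≤ 1 - (1 + v)⁻¹ ≤ v ≤ v ^ ε`; for `v ≥ 1` the right side is
at least one. A small `ε` keeps the singularity in `u` integrable in the next lemma. -/
lemma one_sub_rpow_le {γ ε u h : ℝ} (hγ1 : γ ≤ 1) (hε : 0 ≤ ε) (hε1 : ε ≤ 1)
    (hu : 0 < u) (hh : 0 ≤ h) : 1 - ((u + h) / u) ^ (-γ) ≤ (h / u) ^ ε := by
  have hpos : 0 ≤ h / u := by positivity
  rcases le_total 1 (h / u) with h1 | h1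
  · have h2 : 0 ≤ ((u + h) / u) ^ (-γ) := by positivity
    have h3 := Real.one_le_rpow h1 hε
    linarith
  · have e : (u + h) / u = 1 + h / u := by field_simp
    have h2 : (1 + h / u)⁻¹ ≤ ((u + h) / u) ^ (-γ) := by
      rw [e, ← Real.rpow_neg_one]
      exact Real.rpow_le_rpow_of_exponent_le (by linarith) (by linarith)
    have h3 : 1 - h / u ≤ (1 + h / u)⁻¹ := by
      rw [← sub_nonneg, show (1 + h / u)⁻¹ - (1 - h / u) = (h / u) ^ 2 * (1 + h / u)⁻¹ by
        field_simp; ring]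
      positivity
    have h4 : h / u ≤ (h / u) ^ ε := by
      rcases hpos.eq_or_lt with h5 | h5
      · rw [← h5]; positivity
      · exact Real.self_le_rpow_of_le_one hpos h1 hε1
    linarith

/-- With `u = log (s/x)` and `h = log (t/s)`, `log (t/x) = u + h`, and the integrand is `u^(α-1) (1
- ((u+h)/u)^((α-1)/2)) / Γ(α)`. Taking `ε = α/2` above bounds it by `h^(α/2) u^(α/2-1) / Γ(α)`,
whose integral is a Gamma value. -/
lemma sub_hadamardCov_le (h0 : 0 < α) (h1 : α < 1) {s t : ℝ≥0} (hs : s ≠ 0) (hst : s ≤ t) :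
    s - hadamardCov α s t
      ≤ (Real.Gamma α)⁻¹ * Real.Gamma (α / 2) * (s * Real.log (t / s) ^ (α / 2)) := by
  have hs0 : (0 : ℝ) < s := by positivity
  have hst' : (s : ℝ) ≤ t := by exact_mod_cast hst
  have hI := integral_log_rpow hs0 (a := α / 2) (by linarith)
  have hG := Real.Gamma_pos_of_pos h0
  have e : (Real.Gamma α)⁻¹ * Real.Gamma (α / 2) * (s * Real.log (t / s) ^ (α / 2))
      = ∫ x, indicator (Ioo 0 (s : ℝ)) (fun x => (Real.Gamma α)⁻¹ * Real.log (t / s) ^ (α / 2)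
        * Real.log (s / x) ^ (α / 2 - 1)) x := by
    rw [integral_indicator measurableSet_Ioo, integral_const_mul, hI.2]
    ring
  have e₀ : s - hadamardCov α s t = (∫ x, logKernel α s x * logKernel α s x)
      - ∫ x, logKernel α s x * logKernel α t x := by
    rw [(integral_logKernel_mul_self h0 s).2, hadamardCov]
  rw [e, e₀, ← integral_sub (integrable_logKernel_mul h0 s s) (integrable_logKernel_mul h0 s t)]
  refine integral_mono ((integrable_logKernel_mul h0 s s).sub (integrable_logKernel_mul h0 s t))
    (IntegrableOn.integrable_indicator (hI.1.const_mul _) measurableSet_Ioo) fun x => ?_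
  by_cases hx : x ∈ Ioo 0 (s : ℝ)
  · obtain ⟨hl, hle, hxt⟩ := log_div_le_log_div hst hx
    simp only
    rw [logKernel_mul_of_mem h0 hx hxt, logKernel_mul_of_mem h0 hx hx, indicator_of_mem hx]
    have hadd : Real.log (t / x) = Real.log (s / x) + Real.log (t / s) := by
      rw [← Real.log_mul (div_pos hs0 hx.1).ne' (div_pos (hs0.trans_le hst') hs0).ne']
      congr 1
      have := hx.1.ne'
      field_simp
    set u := Real.log (s / x)
    set h := Real.log (t / s)
    have hh : 0 ≤ h := Real.log_nonneg ((one_le_div hs0).2 hst')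
    have key := one_sub_rpow_le (γ := (1 - α) / 2) (ε := α / 2) (by linarith) (by linarith)
      (by linarith) hl hh
    rw [hadd, mul_assoc, ← mul_sub]
    gcongr
    have e1 : u ^ ((α - 1) / 2) * u ^ ((α - 1) / 2) = u ^ (α - 1) := by
      rw [← Real.rpow_add hl]; ring_nf
    have e2 : u ^ ((α - 1) / 2) * (u + h) ^ ((α - 1) / 2)
        = u ^ (α - 1) * ((u + h) / u) ^ (-((1 - α) / 2)) := by
      rw [show -((1 - α) / 2) = (α - 1) / 2 by ring, Real.div_rpow (by linarith) hl.le, ← e1]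
      have : 0 < u ^ ((α - 1) / 2) := Real.rpow_pos_of_pos hl _
      field_simp
    have e3 : h ^ (α / 2) * u ^ (α / 2 - 1) = u ^ (α - 1) * (h / u) ^ (α / 2) := by
      rw [Real.div_rpow hh hl.le, show α / 2 - 1 = α - 1 - α / 2 by ring, Real.rpow_sub hl]
      ring
    rw [e1, e2, e3, ← mul_one_sub]
    gcongr
  · simp [logKernel, indicator_of_notMem hx]

/-- The variance of the increments is locally Hölder. -/
lemma exists_increment_le (hα : α ∈ Ioo (0 : ℝ) 1 ∪ Ioo (1 : ℝ) 2) :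
    ∃ ε : ℝ, 0 < ε ∧ ∀ T : ℝ≥0, ∃ C : ℝ, 0 ≤ C ∧ ∀ s t : ℝ≥0, s ≤ t → t ≤ T →
      s + t - 2 * hadamardCov α s t ≤ C * ((t : ℝ) - s) ^ ε := by
  rcases hα with h | h
  · have h0 := h.1
    refine ⟨α / 2, by linarith, fun T => ?_⟩
    have hG := Real.Gamma_pos_of_pos h0
    have hG2 := Real.Gamma_pos_of_pos (half_pos h0)
    set c := (Real.Gamma α)⁻¹ * Real.Gamma (α / 2) with hc
    have hc0 : 0 ≤ c := by positivity
    -- The variance is `(t - s) + 2 (s - R(s,t))`. Both `t - s` and `s log (t/s)^(α/2) ≤ s^(1-α/2)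
    -- (t - s)^(α/2)` are at most `T^(1-α/2) (t - s)^(α/2)`.
    refine ⟨(1 + 2 * c) * (T : ℝ) ^ (1 - α / 2), by positivity, fun s t hst htT => ?_⟩
    have hst' : (s : ℝ) ≤ t := by exact_mod_cast hst
    have htT' : (t : ℝ) ≤ T := by exact_mod_cast htT
    have hd : (0 : ℝ) ≤ t - s := by linarith
    have b1 : (t : ℝ) - s ≤ (T : ℝ) ^ (1 - α / 2) * ((t : ℝ) - s) ^ (α / 2) := by
      rcases hd.eq_or_lt with hd0 | hd0
      · rw [← hd0]; positivity
      · calc (t : ℝ) - s = ((t : ℝ) - s) ^ (1 - α / 2) * ((t : ℝ) - s) ^ (α / 2) := by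
              rw [← Real.rpow_add hd0]; simp
          _ ≤ (T : ℝ) ^ (1 - α / 2) * ((t : ℝ) - s) ^ (α / 2) := by
              gcongr
              · linarith [h.2]
              · linarith [s.coe_nonneg]
    have b2 : s - hadamardCov α s t ≤ c * ((T : ℝ) ^ (1 - α / 2) * ((t : ℝ) - s) ^ (α / 2)) := by
      rcases eq_or_ne s 0 with rfl | hs
      · have : hadamardCov α 0 t = 0 := by simp [hadamardCov, logKernel]
        rw [this]
        simp only [NNReal.coe_zero, sub_self, sub_zero]
        positivity
      · refine (sub_hadamardCov_le h0 h.2 hs hst).trans ?_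
        have hs0 : (0 : ℝ) < s := by positivity
        refine mul_le_mul_of_nonneg_left ?_ hc0
        have b3 : Real.log (t / s) ≤ ((t : ℝ) - s) / s := by
          have := Real.log_le_sub_one_of_pos (div_pos (hs0.trans_le hst') hs0)
          rwa [sub_div, div_self hs0.ne']
        calc (s : ℝ) * Real.log (t / s) ^ (α / 2) ≤ s * (((t : ℝ) - s) / s) ^ (α / 2) := by
              gcongr
              exact Real.log_nonneg ((one_le_div hs0).2 hst')
          _ = (s : ℝ) ^ (1 - α / 2) * ((t : ℝ) - s) ^ (α / 2) := by
              rw [Real.div_rpow hd hs0.le, Real.rpow_sub hs0, Real.rpow_one]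
              ring
          _ ≤ _ := by
              gcongr
              · linarith [h.2]
              · linarith
    calc (s : ℝ) + t - 2 * hadamardCov α s t = (t - s) + 2 * (s - hadamardCov α s t) := by ring
      _ ≤ (T : ℝ) ^ (1 - α / 2) * ((t : ℝ) - s) ^ (α / 2)
          + 2 * (c * ((T : ℝ) ^ (1 - α / 2) * ((t : ℝ) - s) ^ (α / 2))) := by gcongr
      _ = _ := by ring
  -- For `α > 1`, `R(s,t) ≥ s` already bounds the variance by `t - s`.
  · refine ⟨1, one_pos, fun T => ⟨1, zero_le_one, fun s t hst _ => ?_⟩⟩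
    have := le_hadamardCov h.1 hst
    rw [Real.rpow_one]
    linarith

end HadamardFBM

namespace HadamardFBM

/-! ### The law of the white noise pairing -/

variable {ν : Measure SchwartzDual}

lemma integral_abs_le_norm_Lp {Ω : Type*} {mΩ : MeasurableSpace Ω} {P : Measure Ω}
    [IsProbabilityMeasure P] (u : Lp ℝ 2 P) : ∫ ω, ‖u ω‖ ∂P ≤ ‖u‖ := by
  have hu := Lp.memLp u
  rw [integral_norm_eq_lintegral_enorm hu.1, ← eLpNorm_one_eq_lintegral_enorm, Lp.norm_def]
  exact ENNReal.toReal_mono hu.2.ne (eLpNorm_le_eLpNorm_of_exponent_le (by norm_num) hu.1)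

lemma norm_exp_I_mul_sub_le (a b : ℝ) :
    ‖Complex.exp (Complex.I * a) - Complex.exp (Complex.I * b)‖ ≤ ‖a - b‖ := by
  have e : Complex.exp (Complex.I * a) - Complex.exp (Complex.I * b)
      = Complex.exp (b * Complex.I) * (Complex.exp (Complex.I * (a - b : ℝ)) - 1) := by
    rw [mul_sub, ← Complex.exp_add, mul_one]
    push_cast
    congr 2 <;> ring
  rw [e, norm_mul, Complex.norm_exp_ofReal_mul_I, one_mul]
  exact Real.norm_exp_I_mul_ofReal_sub_one_le

/-- The functional is 1-Lipschitz: `|e^(ia) - e^(ib)| ≤ |a - b|`, and the `L¹` norm is at most the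
`L²` norm under a probability measure. This lets the characteristic functional pass from Schwartz
functions to `L²`. -/
lemma continuous_integral_exp_I {Ω : Type*} {mΩ : MeasurableSpace Ω} {P : Measure Ω}
    [IsProbabilityMeasure P] :
    Continuous fun g : Lp ℝ 2 P => ∫ ω, Complex.exp (Complex.I * (g ω : ℂ)) ∂P := by
  have hm (g : Lp ℝ 2 P) : Integrable (fun ω => Complex.exp (Complex.I * (g ω : ℂ))) P := by
    have := (Lp.stronglyMeasurable g).measurable
    refine (integrable_const (1 : ℝ)).mono (by fun_prop) (ae_of_all _ fun ω => ?_)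
    rw [mul_comm, Complex.norm_exp_ofReal_mul_I]
    simp
  refine (LipschitzWith.of_dist_le' (K := 1) fun g h => ?_).continuous
  rw [dist_eq_norm, dist_eq_norm, ← integral_sub (hm g) (hm h), one_mul]
  refine le_trans (norm_integral_le_of_norm_le (g := fun ω => ‖(g - h) ω‖)
    ((Lp.memLp (g - h)).integrable (by norm_num)).norm ?_) (integral_abs_le_norm_Lp (g - h))
  filter_upwards [Lp.coeFn_sub g h] with ω hω
  rw [hω]
  exact norm_exp_I_mul_sub_le _ _

/-- The characteristic functional of the extended pairing. -/
lemma integral_exp_whiteNoisePairing (hν : IsWhiteNoise ν) (f : Lp ℝ 2 (volume : Measure ℝ)) :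
    ∫ ω, Complex.exp (Complex.I * (whiteNoisePairing hν f ω : ℂ)) ∂ν
      = Complex.exp (-(1 / 2) * ((‖f‖ ^ 2 : ℝ) : ℂ)) := by
  have := hν.toIsProbabilityMeasure
  refine (SchwartzMap.denseRange_toLpCLM (E := ℝ) (F := ℝ) (p := 2)
    (μ := (volume : Measure ℝ)) (by simp)).induction_on f
    (isClosed_eq (continuous_integral_exp_I.comp (whiteNoisePairing hν).continuous)
      (by fun_prop)) fun φ => ?_
  rw [SchwartzMap.toLpCLM_apply, whiteNoisePairing_toLp]
  have e : ‖φ.toLp 2 (volume : Measure ℝ)‖ ^ 2 = ∫ x, φ x ^ 2 := by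
    rw [← real_inner_self_eq_norm_sq, L2.inner_def]
    apply integral_congr_ae
    filter_upwards [φ.coeFn_toLp 2 volume] with ω h
    simp [h, pow_two]
  rw [e, ← hν.charFun_eq φ]
  refine integral_congr_ae ?_
  filter_upwards [(hν.memLp φ).coeFn_toLp] with ω h
  rw [h]

lemma hasLaw_whiteNoisePairing (hν : IsWhiteNoise ν) (f : Lp ℝ 2 (volume : Measure ℝ)) :
    HasLaw (whiteNoisePairing hν f) (gaussianReal 0 (‖f‖ ^ 2).toNNReal) ν := by
  have := hν.toIsProbabilityMeasure
  have hm : AEMeasurable (whiteNoisePairing hν f) ν := (Lp.aestronglyMeasurable _).aemeasurable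
  refine ⟨hm, ?_⟩
  have : IsProbabilityMeasure (ν.map (whiteNoisePairing hν f)) :=
    Measure.isProbabilityMeasure_map hm
  apply Measure.ext_of_charFun
  funext k
  rw [charFun_gaussianReal, charFun_apply_real, integral_map hm (by fun_prop)]
  have h := integral_exp_whiteNoisePairing hν (k • f)
  rw [norm_smul, mul_pow, map_smul] at h
  rw [Real.coe_toNNReal _ (sq_nonneg ‖f‖)]
  convert h using 1
  · refine integral_congr_ae ?_
    filter_upwards [Lp.coeFn_smul k (whiteNoisePairing hν f)] with ω hω
    rw [hω]
    simp only [Pi.smul_apply, smul_eq_mul]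
    push_cast
    ring_nf
  · congr 1
    simp
    ring

variable {α : ℝ}

/-- The kernel as an element of `L²(ℝ)`. -/
noncomputable def kernelLp (h0 : 0 < α) (t : ℝ≥0) : Lp ℝ 2 (volume : Measure ℝ) :=
  (memLp_logKernel h0 t).toLp

lemma pos_of_mem (hα : α ∈ Ioo (0 : ℝ) 1 ∪ Ioo (1 : ℝ) 2) : 0 < α := by
  rcases hα with h | h
  · exact h.1
  · linarith [h.1]

lemma hadamardFBM_eq (hν : IsWhiteNoise ν) (hα : α ∈ Ioo (0 : ℝ) 1 ∪ Ioo (1 : ℝ) 2) (t : ℝ≥0) :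
    hadamardFBM hν α t = whiteNoisePairing hν (kernelLp (pos_of_mem hα) t) := by
  have hae := hadamardKernel_ae_eq hα t
  have h : MemLp (hadamardKernel α t) 2 (volume : Measure ℝ) :=
    (memLp_congr_ae hae).2 (memLp_logKernel (pos_of_mem hα) t)
  rw [hadamardFBM, dif_pos h, kernelLp]
  congr 1
  exact (MemLp.toLp_eq_toLp_iff _ _).2 hae

lemma inner_kernelLp (h0 : 0 < α) (s t : ℝ≥0) :
    inner ℝ (kernelLp h0 s) (kernelLp h0 t) = hadamardCov α s t := by
  rw [L2.inner_def, hadamardCov]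
  apply integral_congr_ae
  filter_upwards [(memLp_logKernel h0 s).coeFn_toLp, (memLp_logKernel h0 t).coeFn_toLp]
    with x hs ht
  simp [kernelLp, hs, ht, mul_comm]

lemma norm_kernelLp_sub_sq (h0 : 0 < α) (s t : ℝ≥0) :
    ‖kernelLp h0 s - kernelLp h0 t‖ ^ 2 = s + t - 2 * hadamardCov α s t := by
  rw [@norm_sub_sq_real, inner_kernelLp, ← real_inner_self_eq_norm_sq, ← real_inner_self_eq_norm_sq,
    inner_kernelLp, inner_kernelLp, hadamardCov_self h0, hadamardCov_self h0]
  ring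

lemma exists_norm_kernelLp_sub_sq_le (hα : α ∈ Ioo (0 : ℝ) 1 ∪ Ioo (1 : ℝ) 2) :
    ∃ ε : ℝ, 0 < ε ∧ ∀ T : ℝ≥0, ∃ C : ℝ, 0 ≤ C ∧ ∀ s ≤ T, ∀ t ≤ T,
      ‖kernelLp (pos_of_mem hα) s - kernelLp (pos_of_mem hα) t‖ ^ 2 ≤ C * |(s : ℝ) - t| ^ ε := by
  obtain ⟨ε, hε, h⟩ := exists_increment_le hα
  refine ⟨ε, hε, fun T => ?_⟩
  obtain ⟨C, hC, hCT⟩ := h T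
  refine ⟨C, hC, fun s hs t ht => ?_⟩
  rcases le_total s t with hst | hst
  · have hst' : (s : ℝ) ≤ t := by exact_mod_cast hst
    rw [norm_kernelLp_sub_sq, abs_sub_comm, abs_of_nonneg (by linarith)]
    exact hCT s t hst ht
  · have hst' : (t : ℝ) ≤ s := by exact_mod_cast hst
    rw [norm_sub_rev, norm_kernelLp_sub_sq, abs_of_nonneg (by linarith)]
    exact hCT t s hst hs

lemma continuous_kernelLp (hα : α ∈ Ioo (0 : ℝ) 1 ∪ Ioo (1 : ℝ) 2) :
    Continuous (kernelLp (pos_of_mem hα)) := by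
  obtain ⟨ε, hε, h⟩ := exists_norm_kernelLp_sub_sq_le hα
  rw [continuous_iff_continuousAt]
  intro t
  obtain ⟨C, hC, hCT⟩ := h (t + 1)
  rw [ContinuousAt, tendsto_iff_norm_sub_tendsto_zero]
  have h1 : Tendsto (fun s : ℝ≥0 => √(C * |(s : ℝ) - t| ^ ε)) (𝓝 t) (𝓝 0) := by
    have : Continuous fun s : ℝ≥0 => √(C * |(s : ℝ) - t| ^ ε) := by
      refine (continuous_const.mul (Continuous.rpow_const (by fun_prop)
        fun _ => Or.inr hε.le)).sqrt
    simpa [Real.zero_rpow hε.ne'] using this.tendsto t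
  refine squeeze_zero' (Eventually.of_forall fun s => norm_nonneg _) ?_ h1
  filter_upwards [Iic_mem_nhds (lt_add_one t)] with s hs
  exact Real.le_sqrt_of_sq_le (hCT s hs t (le_add_of_nonneg_right zero_le_one))

theorem tendstoInMeasure_hadamardFBM (hν : IsWhiteNoise ν)
    (hα : α ∈ Ioo (0 : ℝ) 1 ∪ Ioo (1 : ℝ) 2) (t : ℝ≥0) :
    TendstoInMeasure ν (fun s => (hadamardFBM hν α s : SchwartzDual → ℝ)) (𝓝 t)
      (hadamardFBM hν α t) := by
  refine tendstoInMeasure_of_tendsto_Lp ?_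
  rw [show hadamardFBM hν α = whiteNoisePairing hν ∘ kernelLp (pos_of_mem hα) from
    funext (hadamardFBM_eq hν hα)]
  exact ((whiteNoisePairing hν).continuous.comp (continuous_kernelLp hα)).tendsto t

/-- The covariance matrix of a process at finitely many times. -/
def covMatrixOn (R : ℝ≥0 → ℝ≥0 → ℝ) (I : Finset ℝ≥0) : Matrix I I ℝ :=
  Matrix.of fun i j => R i j

/-- `X` is a centered Gaussian process with covariance function `R`. -/
structure IsCenteredGaussian {Ω : Type*} {mΩ : MeasurableSpace Ω} (X : ℝ≥0 → Ω → ℝ) (P : Measure Ω)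
    (R : ℝ≥0 → ℝ≥0 → ℝ) : Prop where
  posSemidef : ∀ I, (covMatrixOn R I).PosSemidef
  hasLaw : ∀ I : Finset ℝ≥0, HasLaw (fun ω => WithLp.toLp 2 fun i : I => X i ω)
    (multivariateGaussian 0 (covMatrixOn R I)) P

/-- By linearity of the pairing, a combination of the `Y i` is almost surely the pairing with the
same combination of kernels. The joint characteristic function is thus governed by its squared norm,
the quadratic form of a Gram matrix. -/
lemma isCenteredGaussian_of_isVersion (hν : IsWhiteNoise ν)
    (hα : α ∈ Ioo (0 : ℝ) 1 ∪ Ioo (1 : ℝ) 2) {Y : ℝ≥0 → SchwartzDual → ℝ}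
    (hY : IsVersion hν α Y) : IsCenteredGaussian Y ν (hadamardCov α) := by
  have := hν.toIsProbabilityMeasure
  have hpos := pos_of_mem hα
  have hgram (I : Finset ℝ≥0) : covMatrixOn (hadamardCov α) I
      = Matrix.gram ℝ fun i : I => kernelLp hpos i := by
    ext i j
    simp [covMatrixOn, inner_kernelLp]
  have hpsd (I : Finset ℝ≥0) : (covMatrixOn (hadamardCov α) I).PosSemidef := by
    rw [hgram]; exact Matrix.posSemidef_gram _ _
  refine ⟨hpsd, fun I => ?_⟩
  have hYW (t : ℝ≥0) : Y t =ᵐ[ν] whiteNoisePairing hν (kernelLp hpos t) := by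
    rw [← hadamardFBM_eq hν hα]; exact hY t
  have hmY (t : ℝ≥0) : AEMeasurable (Y t) ν :=
    (Lp.aestronglyMeasurable (whiteNoisePairing hν (kernelLp hpos t))).aemeasurable.congr
      (hYW t).symm
  have hm : AEMeasurable (fun ω => WithLp.toLp 2 fun i : I => Y i ω) ν :=
    (WithLp.measurable_toLp 2 (I → ℝ)).comp_aemeasurable (aemeasurable_pi_lambda _ fun i => hmY i)
  refine ⟨hm, ?_⟩
  have : IsProbabilityMeasure (ν.map (fun ω => WithLp.toLp 2 fun i : I => Y i ω)) :=
    Measure.isProbabilityMeasure_map hm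
  apply Measure.ext_of_charFun
  funext u
  rw [charFun_multivariateGaussian (hpsd I), charFun_apply, integral_map hm (by fun_prop)]
  have h := integral_exp_whiteNoisePairing hν (∑ i : I, u i • kernelLp hpos i)
  have hsum : whiteNoisePairing hν (∑ i : I, u i • kernelLp hpos i)
      =ᵐ[ν] fun ω => ∑ i : I, u i * Y i ω := by
    rw [map_sum]
    have h1 : ∀ᵐ ω ∂ν, ∀ i : I, (whiteNoisePairing hν (u i • kernelLp hpos i)) ω
        = u i * Y i ω := by
      refine ae_all_iff.2 fun i => ?_
      rw [map_smul]
      filter_upwards [Lp.coeFn_smul (u i) (whiteNoisePairing hν (kernelLp hpos i)), hYW i]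
        with ω h1 h2
      rw [h1, h2, Pi.smul_apply, smul_eq_mul]
    filter_upwards [Lp.coeFn_finsetSum Finset.univ fun i : I =>
      whiteNoisePairing hν (u i • kernelLp hpos i), h1] with ω h2 h3
    rw [h2, Finset.sum_apply]
    exact Finset.sum_congr rfl fun i _ => h3 i
  have hnorm : ‖∑ i : I, u i • kernelLp hpos i‖ ^ 2
      = u.ofLp ⬝ᵥ (covMatrixOn (hadamardCov α) I).mulVec u.ofLp := by
    rw [hgram, ← real_inner_self_eq_norm_sq, ← Matrix.star_dotProduct_gram_mulVec]
    simp
  rw [hnorm] at h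
  convert h using 1
  · refine integral_congr_ae ?_
    filter_upwards [hsum] with ω hω
    rw [hω, mul_comm]
    congr 3
  · congr 1
    simp
    ring

end HadamardFBM

namespace HadamardFBM

/-! ### Continuous modifications of Gaussian processes -/

section Continuity

variable {Ω : Type*} {mΩ : MeasurableSpace Ω} {P : Measure Ω} {X Y Z : ℝ≥0 → Ω → ℝ}

lemma integral_pow_gaussianReal (v : ℝ≥0) (m : ℕ) :
    Integrable (fun x : ℝ => |x| ^ (2 * m)) (gaussianReal 0 v) ∧
      ∫ x, |x| ^ (2 * m) ∂(gaussianReal 0 v)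
        = (v : ℝ) ^ m * ∫ x, |x| ^ (2 * m) ∂(gaussianReal 0 1) := by
  constructor
  · rcases Nat.eq_zero_or_pos m with rfl | hm
    · simp
    exact (memLp_id_gaussianReal (μ := 0) (v := v) ((2 * m : ℕ) : ℝ≥0)).integrable_norm_pow
      (p := 2 * m) (by omega)
  · have h := gaussianReal_map_const_mul (μ := 0) (v := 1) (√v)
    have e : NNReal.mk (√(v : ℝ) ^ 2) (sq_nonneg _) * 1 = v := by
      ext
      simp [Real.sq_sqrt]
    rw [mul_zero, e] at h
    rw [← h, integral_map (by fun_prop) (by fun_prop), ← integral_const_mul]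
    congr 1
    ext x
    rw [abs_mul, mul_pow, abs_of_nonneg (Real.sqrt_nonneg _), pow_mul, Real.sq_sqrt v.coe_nonneg]

/-- A process with centered Gaussian increments whose variances are locally Hölder has a
continuous modification, with integrable bounds on compact intervals. -/
theorem exists_continuous_modification_of_gaussian [IsProbabilityMeasure P]
    (hi : ∀ t, Integrable (X t) P) {v : ℝ≥0 → ℝ≥0 → ℝ≥0}
    (hlaw : ∀ s t, HasLaw (fun ω => X s ω - X t ω) (gaussianReal 0 (v s t)) P) {ε : ℝ} (hε : 0 < ε)
    (hv : ∀ T : ℝ≥0, ∃ C : ℝ, 0 ≤ C ∧ ∀ s ≤ T, ∀ t ≤ T, (v s t : ℝ) ≤ C * |(s : ℝ) - t| ^ ε) :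
    ∃ Z : ℝ≥0 → Ω → ℝ, (∀ t, Measurable (Z t)) ∧ (∀ ω, Continuous fun t => Z t ω) ∧
      (∀ t, Z t =ᵐ[P] X t) ∧
      ∀ T : ℝ≥0, ∃ g : Ω → ℝ, Integrable g P ∧ ∀ᵐ ω ∂P, ∀ s ≤ T, |Z s ω| ≤ g ω := by
  -- The moment of order `2 m` is a multiple of the `m`-th power of the variance; `m ε ≥ 2` supplies
  -- the exponent needed by Kolmogorov's criterion, and the surplus is absorbed by `T ^ (ε m - 2)`.
  obtain ⟨m, hm⟩ := exists_nat_ge (2 / ε)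
  rw [div_le_iff₀ hε] at hm
  have hm0 : m ≠ 0 := by
    rintro rfl
    simp at hm
    linarith
  have hmk (t : ℝ≥0) : X t =ᵐ[P] (hi t).1.aemeasurable.mk (X t) := (hi t).1.aemeasurable.ae_eq_mk
  obtain ⟨Z, h1, h2, h3, h4⟩ := exists_continuous_modification (P := P) (p := 2 * m)
    (X := fun t => (hi t).1.aemeasurable.mk (X t)) (by omega)
    (fun t => (hi t).1.aemeasurable.measurable_mk) (fun t => (hi t).congr (hmk t)) (fun T => by
      obtain ⟨C, hC, hCT⟩ := hv T
      refine ⟨C ^ m * (T : ℝ) ^ (ε * m - 2) * ∫ x, |x| ^ (2 * m) ∂(gaussianReal 0 1),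
        fun s hs t ht => ?_⟩
      have hsub : (fun ω => |X s ω - X t ω| ^ (2 * m)) =ᵐ[P] fun ω =>
          |(hi s).1.aemeasurable.mk (X s) ω - (hi t).1.aemeasurable.mk (X t) ω| ^ (2 * m) := by
        filter_upwards [hmk s, hmk t] with ω hs ht
        rw [hs, ht]
      have hg := integral_pow_gaussianReal (v s t) m
      have hms : AEStronglyMeasurable (fun x : ℝ => |x| ^ (2 * m))
        (P.map fun ω => X s ω - X t ω) := by fun_prop
      constructor
      · refine Integrable.congr ?_ hsub
        have := hg.1
        rw [← (hlaw s t).map_eq] at this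
        exact (integrable_map_measure hms (hlaw s t).aemeasurable).1 this
      · rw [← integral_congr_ae hsub]
        have e : ∫ ω, |X s ω - X t ω| ^ (2 * m) ∂P
            = ∫ x, |x| ^ (2 * m) ∂(gaussianReal 0 (v s t)) := by
          rw [← (hlaw s t).map_eq, integral_map (hlaw s t).aemeasurable hms]
        rw [e, hg.2]
        have hT : |(s : ℝ) - t| ≤ T := by
          have hs' : (s : ℝ) ≤ T := by exact_mod_cast hs
          have ht' : (t : ℝ) ≤ T := by exact_mod_cast ht
          exact abs_le.2 ⟨by linarith [s.coe_nonneg], by linarith [t.coe_nonneg]⟩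
        have hI : 0 ≤ ∫ x : ℝ, |x| ^ (2 * m) ∂(gaussianReal 0 1) :=
          integral_nonneg fun x => by positivity
        have hb : (v s t : ℝ) ^ m ≤ C ^ m * (T : ℝ) ^ (ε * m - 2) * ((s : ℝ) - t) ^ 2 := by
          calc (v s t : ℝ) ^ m ≤ (C * |(s : ℝ) - t| ^ ε) ^ m := by
                gcongr
                exact hCT s hs t ht
            _ = C ^ m * |(s : ℝ) - t| ^ (ε * m) := by
                rw [mul_pow, ← Real.rpow_natCast (_ ^ ε), ← Real.rpow_mul (abs_nonneg _)]
            _ ≤ C ^ m * ((T : ℝ) ^ (ε * m - 2) * |(s : ℝ) - t| ^ (2 : ℝ)) := by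
                gcongr
                rcases (abs_nonneg ((s : ℝ) - t)).eq_or_lt with h0 | h0
                · rw [← h0, Real.zero_rpow (by positivity)]
                  positivity
                · calc |(s : ℝ) - t| ^ (ε * m)
                      = |(s : ℝ) - t| ^ (ε * m - 2) * |(s : ℝ) - t| ^ (2 : ℝ) := by
                        rw [← Real.rpow_add h0]; ring_nf
                    _ ≤ _ := by
                        gcongr
                        linarith
            _ = _ := by
                rw [Real.rpow_two, sq_abs]
                ring
        calc (v s t : ℝ) ^ m * ∫ x, |x| ^ (2 * m) ∂(gaussianReal 0 1)
            ≤ C ^ m * (T : ℝ) ^ (ε * m - 2) * ((s : ℝ) - t) ^ 2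
              * ∫ x, |x| ^ (2 * m) ∂(gaussianReal 0 1) := by gcongr
          _ = _ := by ring)
  exact ⟨Z, h1, h2, fun t => (h3 t).trans (hmk t).symm, h4⟩

lemma ae_forall_eq_of_continuous (hX : ∀ᵐ ω ∂P, Continuous fun t => X t ω)
    (hZ : ∀ ω, Continuous fun t => Z t ω) (h : ∀ t, X t =ᵐ[P] Z t) :
    ∀ᵐ ω ∂P, ∀ t, X t ω = Z t ω := by
  filter_upwards [hX, ae_all_iff.2 fun n => h (TopologicalSpace.denseSeq ℝ≥0 n)] with ω hω hd t
  refine congrFun ((TopologicalSpace.denseRange_denseSeq ℝ≥0).equalizer hω (hZ ω) ?_) t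
  funext n
  exact hd n

/-- A separable version of a process with continuous paths is indistinguishable from it. -/
lemma ae_forall_eq_of_isSeparableProcess (hY : IsSeparableProcess Y P)
    (hZ : ∀ ω, Continuous fun t => Z t ω) (h : ∀ t, Y t =ᵐ[P] Z t) :
    ∀ᵐ ω ∂P, ∀ t, Y t ω = Z t ω := by
  obtain ⟨D, hD, hsep⟩ := hY
  filter_upwards [hsep, (ae_ball_iff hD).2 fun t _ => h t] with ω hω hd t
  rw [← dist_le_zero]
  refine le_of_forall_pos_le_add fun δ hδ => ?_
  rw [zero_add]
  -- On `U` the continuous path stays in a closed `δ`-ball around `Z t ω`. The two paths agree on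
  -- `D`, so separability forces `Y t ω` into the same ball.
  obtain ⟨U, hU, hUo, htU⟩ := eventually_nhds_iff.1
    (((hZ ω).tendsto t).eventually (Metric.closedBall_mem_nhds (Z t ω) hδ))
  exact hω U hUo (Metric.closedBall (Z t ω) δ) Metric.isClosed_closedBall
    (fun s hs => by rw [hd s hs.2]; exact hU s hs.1) t htU

end Continuity

/-! ### Running suprema -/

section RunningSup

variable {Ω : Type*} {mΩ : MeasurableSpace Ω} {P : Measure Ω} {X : ℝ≥0 → Ω → ℝ}

lemma pathBddAbove_of_continuous {ω : Ω} (h : Continuous fun s => X s ω) (t : ℝ≥0) :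
    PathBddAbove X t ω :=
  isCompact_Icc.bddAbove_image h.continuousOn

lemma bddAbove_range_of_pathBddAbove {t : ℝ≥0} {ω : Ω} (h : PathBddAbove X t ω) :
    BddAbove (range fun s : Icc (0 : ℝ≥0) t => X s ω) := by
  rwa [PathBddAbove, image_eq_range] at h

lemma lt_runningSup_iff {ω : Ω} (h : Continuous fun s => X s ω) (t : ℝ≥0) (x : ℝ) :
    x < runningSup X t ω ↔
      ∃ n, x < X (haveI : Nonempty (Icc (0 : ℝ≥0) t) := ⟨⟨0, by simp⟩⟩;
        TopologicalSpace.denseSeq (Icc (0 : ℝ≥0) t) n) ω := by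
  have : Nonempty (Icc (0 : ℝ≥0) t) := ⟨⟨0, by simp⟩⟩
  rw [runningSup, lt_ciSup_iff (bddAbove_range_of_pathBddAbove (pathBddAbove_of_continuous h t))]
  constructor
  · intro ⟨s, hs⟩
    have ho : IsOpen {s : Icc (0 : ℝ≥0) t | x < X s ω} :=
      isOpen_lt continuous_const (h.comp continuous_subtype_val)
    exact (TopologicalSpace.denseRange_denseSeq _).exists_mem_open ho ⟨s, hs⟩
  · exact fun ⟨n, hn⟩ => ⟨_, hn⟩

lemma le_runningSup {ω : Ω} (h : Continuous fun s => X s ω) {s t : ℝ≥0} (hs : s ≤ t) :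
    X s ω ≤ runningSup X t ω :=
  le_ciSup (bddAbove_range_of_pathBddAbove (pathBddAbove_of_continuous h t))
    (⟨s, zero_le, hs⟩ : Icc (0 : ℝ≥0) t)

lemma integrable_runningSup (hm : ∀ t, Measurable (X t)) (hc : ∀ ω, Continuous fun t => X t ω)
    {t : ℝ≥0} {g : Ω → ℝ} (hg : Integrable g P) (hb : ∀ᵐ ω ∂P, ∀ s ≤ t, |X s ω| ≤ g ω) :
    Integrable (runningSup X t) P := by
  have : Nonempty (Icc (0 : ℝ≥0) t) := ⟨⟨0, by simp⟩⟩
  have hmeas : Measurable (runningSup X t) := by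
    refine measurable_of_Ioi fun x => ?_
    have : runningSup X t ⁻¹' Ioi x
        = ⋃ n, {ω | x < X (TopologicalSpace.denseSeq (Icc (0 : ℝ≥0) t) n) ω} := by
      ext ω
      simp [lt_runningSup_iff (hc ω)]
    rw [this]
    exact MeasurableSet.iUnion fun n => measurableSet_lt measurable_const (hm _)
  refine hg.mono hmeas.aestronglyMeasurable ?_
  filter_upwards [hb] with ω hω
  refine le_trans ?_ (le_abs_self _)
  refine abs_le.2 ⟨?_, ciSup_le fun s => (le_abs_self _).trans (hω s s.2.2)⟩
  exact (abs_le.1 (hω 0 zero_le)).1.trans (le_runningSup (hc ω) zero_le)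

lemma runningSup_congr {Z : ℝ≥0 → Ω → ℝ} {ω : Ω} (h : ∀ s, X s ω = Z s ω) (t : ℝ≥0) :
    runningSup X t ω = runningSup Z t ω := by
  simp only [runningSup, h]

end RunningSup

/-! ### Comparison of suprema -/

section Comparison

variable {Ω Ω' : Type*} {mΩ : MeasurableSpace Ω} {mΩ' : MeasurableSpace Ω'} {P : Measure Ω}
  {Q : Measure Ω'} {U : ℝ≥0 → Ω → ℝ} {V : ℝ≥0 → Ω' → ℝ} {R S : ℝ≥0 → ℝ≥0 → ℝ}

lemma IsCenteredGaussian.measure_exists_lt (hU : IsCenteredGaussian U P R) (I : Finset ℝ≥0)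
    (x : ℝ) : P {ω | ∃ i ∈ I, x < U i ω}
      = 1 - multivariateGaussian 0 (covMatrixOn R I) {y | ∀ i, y i ≤ x} := by
  have hms : MeasurableSet {y : EuclideanSpace ℝ I | ∀ i, y i ≤ x} := by
    rw [ofPred_forall]
    exact MeasurableSet.iInter fun i => measurableSet_le (by fun_prop) measurable_const
  rw [← prob_compl_eq_one_sub hms, ← (hU.hasLaw I).map_eq,
    Measure.map_apply_of_aemeasurable (hU.hasLaw I).aemeasurable hms.compl]
  congr 1
  ext ω
  simp

/-- A fixed dense sequence in `[0, t]`. -/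
noncomputable def denseTimes (t : ℝ≥0) (n : ℕ) : ℝ≥0 :=
  haveI : Nonempty (Icc (0 : ℝ≥0) t) := ⟨⟨0, by simp⟩⟩
  TopologicalSpace.denseSeq (Icc (0 : ℝ≥0) t) n

/-- Continuity reduces the event to an increasing union over finite sets of times. These times do
not depend on the process, so two processes can be compared term by term. -/
lemma measure_lt_runningSup_eq (hc : ∀ᵐ ω ∂P, Continuous fun s => U s ω) (t : ℝ≥0) (x : ℝ) :
    P {ω | x < runningSup U t ω}
      = ⨆ n, P {ω | ∃ i ∈ (Finset.range n).image (denseTimes t), x < U i ω} := by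
  have hmono : Monotone fun n => {ω | ∃ i ∈ (Finset.range n).image (denseTimes t), x < U i ω} := by
    intro m n hmn ω ⟨i, hi, hx⟩
    exact ⟨i, Finset.image_subset_image (Finset.range_mono hmn) hi, hx⟩
  rw [← hmono.measure_iUnion]
  refine measure_congr ?_
  filter_upwards [hc] with ω hω
  refine propext ((lt_runningSup_iff hω t x).trans ?_)
  change _ ↔ ω ∈ (⋃ n, {ω | ∃ i ∈ (Finset.range n).image (denseTimes t), x < U i ω})
  rw [mem_iUnion]
  constructor
  · rintro ⟨n, hn⟩
    exact ⟨n + 1, _, Finset.mem_image_of_mem _ (Finset.self_mem_range_succ n), hn⟩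
  · rintro ⟨n, i, hi, hx⟩
    obtain ⟨k, -, rfl⟩ := Finset.mem_image.1 hi
    exact ⟨k, hx⟩

/-- Slepian's comparison of the suprema of two centered Gaussian processes. -/
theorem measure_lt_runningSup_le (hU : IsCenteredGaussian U P R) (hV : IsCenteredGaussian V Q S)
    (hUc : ∀ᵐ ω ∂P, Continuous fun s => U s ω) (hVc : ∀ᵐ ω ∂Q, Continuous fun s => V s ω)
    (hd : ∀ t, R t t = S t t) (hRS : ∀ s t, R s t ≤ S s t) (t : ℝ≥0) (x : ℝ) :
    Q {ω | x < runningSup V t ω} ≤ P {ω | x < runningSup U t ω} := by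
  rw [measure_lt_runningSup_eq hUc, measure_lt_runningSup_eq hVc]
  refine iSup_mono fun n => ?_
  rw [hU.measure_exists_lt, hV.measure_exists_lt]
  exact tsub_le_tsub_left (slepian (hU.posSemidef _) (hV.posSemidef _) (fun i => hd i)
    (fun i j => hRS i j) x) 1

/-- The mean of a nonnegative variable is the integral of its tail. -/
lemma integral_le_of_measure_lt_le {f : Ω → ℝ} {g : Ω' → ℝ} (hf : Integrable f P)
    (hg : Integrable g Q) (hf0 : 0 ≤ᵐ[P] f) (hg0 : 0 ≤ᵐ[Q] g)
    (h : ∀ x : ℝ, Q {ω | x < g ω} ≤ P {ω | x < f ω}) : ∫ ω, g ω ∂Q ≤ ∫ ω, f ω ∂P := by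
  have hfin : ∫⁻ ω, ENNReal.ofReal (f ω) ∂P ≠ ∞ := by
    rw [← ofReal_integral_eq_lintegral_ofReal hf hf0]
    exact ENNReal.ofReal_ne_top
  rw [integral_eq_lintegral_of_nonneg_ae hf0 hf.1, integral_eq_lintegral_of_nonneg_ae hg0 hg.1]
  refine ENNReal.toReal_mono hfin ?_
  rw [lintegral_eq_lintegral_meas_lt P hf0 hf.aemeasurable,
    lintegral_eq_lintegral_meas_lt Q hg0 hg.aemeasurable]
  exact lintegral_mono fun x => h x

lemma runningSup_nonneg (hUc : ∀ᵐ ω ∂P, Continuous fun s => U s ω) (h0 : ∀ᵐ ω ∂P, U 0 ω = 0)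
    (t : ℝ≥0) : 0 ≤ᵐ[P] runningSup U t := by
  filter_upwards [hUc, h0] with ω hc h
  exact h.symm.le.trans (le_runningSup hc zero_le)

end Comparison

end HadamardFBM

namespace HadamardFBM

/-! ### Brownian motion and the Hadamard fractional Brownian motion -/

section Brownian

variable {Ω : Type*} {mΩ : MeasurableSpace Ω} {P : Measure Ω} {B : ℝ≥0 → Ω → ℝ}

lemma isCenteredGaussian_of_isPreBrownianReal (hB : IsPreBrownianReal B P) :
    IsCenteredGaussian B P fun s t => ((min s t : ℝ≥0) : ℝ) where
  posSemidef I := by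
    convert BrownianReal.posSemidef_covMatrix I using 1
    ext i j
    simp [covMatrixOn]
  hasLaw I := by
    have e : covMatrixOn (fun s t => ((min s t : ℝ≥0) : ℝ)) I = BrownianReal.covMatrix I := by
      ext i j
      simp [covMatrixOn]
    rw [e]
    exact (BrownianReal.measurePreserving_toLp_projectiveFamily I).hasLaw.comp (hB.hasLaw I)

lemma integrable_runningSup_of_isBrownianReal (hB : IsBrownianReal B P) (t : ℝ≥0) :
    Integrable (runningSup B t) P := by
  have : IsProbabilityMeasure P := hB.isGaussianProcess.isProbabilityMeasure
  obtain ⟨Z, hZm, hZc, hZB, hZb⟩ := exists_continuous_modification_of_gaussian (P := P) (X := B)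
    hB.integrable_eval (fun s t => hB.hasLaw_sub s t) one_pos
    (fun T => ⟨1, zero_le_one, fun s _ t _ => by
      rw [Real.rpow_one, one_mul, coe_nndist]
      exact (Real.dist_eq _ _).le⟩)
  obtain ⟨g, hg, hgb⟩ := hZb t
  refine (integrable_runningSup hZm hZc hg hgb).congr ?_
  filter_upwards [ae_forall_eq_of_continuous hB.cont hZc fun s => (hZB s).symm] with ω hω
  exact (runningSup_congr hω t).symm

end Brownian

section Hadamard

variable {ν : Measure SchwartzDual} {α : ℝ}

theorem exists_continuous_version (hν : IsWhiteNoise ν)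
    (hα : α ∈ Ioo (0 : ℝ) 1 ∪ Ioo (1 : ℝ) 2) :
    ∃ Z : ℝ≥0 → SchwartzDual → ℝ, (∀ t, Measurable (Z t)) ∧ (∀ ω, Continuous fun t => Z t ω) ∧
      IsVersion hν α Z ∧
      ∀ T : ℝ≥0, ∃ g : SchwartzDual → ℝ, Integrable g ν ∧ ∀ᵐ ω ∂ν, ∀ s ≤ T, |Z s ω| ≤ g ω := by
  have := hν.toIsProbabilityMeasure
  have hpos := pos_of_mem hα
  obtain ⟨ε, hε, hC⟩ := exists_norm_kernelLp_sub_sq_le hα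
  refine exists_continuous_modification_of_gaussian (P := ν)
    (X := fun t => (hadamardFBM hν α t : SchwartzDual → ℝ))
    (v := fun s t => (‖kernelLp hpos s - kernelLp hpos t‖ ^ 2).toNNReal)
    (fun t => (Lp.memLp _).integrable (by norm_num)) (fun s t => ?_) hε (fun T => ?_)
  · refine (hasLaw_whiteNoisePairing hν (kernelLp hpos s - kernelLp hpos t)).congr ?_
    rw [map_sub, hadamardFBM_eq hν hα, hadamardFBM_eq hν hα]
    exact (Lp.coeFn_sub _ _).symm
  · obtain ⟨C, hC0, hCT⟩ := hC T
    refine ⟨C, hC0, fun s hs t ht => ?_⟩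
    rw [Real.coe_toNNReal _ (sq_nonneg _)]
    exact hCT s hs t ht

lemma hadamardFBM_zero (hν : IsWhiteNoise ν) (hα : α ∈ Ioo (0 : ℝ) 1 ∪ Ioo (1 : ℝ) 2) :
    hadamardFBM hν α 0 = 0 := by
  have hpos := pos_of_mem hα
  have : kernelLp hpos 0 = 0 := by
    rw [← norm_eq_zero, ← sq_eq_zero_iff, ← real_inner_self_eq_norm_sq, inner_kernelLp,
      hadamardCov_self hpos, NNReal.coe_zero]
  rw [hadamardFBM_eq hν hα, this, map_zero]

lemma ae_eq_zero_of_isVersion (hν : IsWhiteNoise ν) (hα : α ∈ Ioo (0 : ℝ) 1 ∪ Ioo (1 : ℝ) 2)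
    {Y : ℝ≥0 → SchwartzDual → ℝ} (hY : IsVersion hν α Y) : ∀ᵐ ω ∂ν, Y 0 ω = 0 := by
  have h := hY 0
  rw [hadamardFBM_zero hν hα] at h
  exact h.trans (Lp.coeFn_zero _ _ _)

lemma continuous_of_isSeparableProcess (hν : IsWhiteNoise ν)
    (hα : α ∈ Ioo (0 : ℝ) 1 ∪ Ioo (1 : ℝ) 2) {Y : ℝ≥0 → SchwartzDual → ℝ}
    (hY : IsVersion hν α Y) (hs : IsSeparableProcess Y ν) :
    (∀ᵐ ω ∂ν, Continuous fun t => Y t ω) ∧ ∀ t, Integrable (runningSup Y t) ν := by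
  obtain ⟨Z, hZm, hZc, hZ, hZb⟩ := exists_continuous_version hν hα
  have h := ae_forall_eq_of_isSeparableProcess hs hZc fun t => (hY t).trans (hZ t).symm
  constructor
  · filter_upwards [h] with ω hω
    rw [funext hω]
    exact hZc ω
  · intro t
    obtain ⟨g, hg, hgb⟩ := hZb t
    refine (integrable_runningSup hZm hZc hg hgb).congr ?_
    filter_upwards [h] with ω hω
    exact (runningSup_congr hω t).symm

lemma hadamardCov_le_min (h0 : 0 < α) (h1 : α < 1) (s t : ℝ≥0) :
    hadamardCov α s t ≤ (min s t : ℝ≥0) := by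
  rcases le_total s t with h | h
  · rw [min_eq_left h]
    exact hadamardCov_le h0 h1 h
  · rw [min_eq_right h, hadamardCov_comm]
    exact hadamardCov_le h0 h1 h

lemma min_le_hadamardCov (h1 : 1 < α) (s t : ℝ≥0) : (min s t : ℝ≥0) ≤ hadamardCov α s t := by
  rcases le_total s t with h | h
  · rw [min_eq_left h]
    exact le_hadamardCov h1 h
  · rw [min_eq_right h, hadamardCov_comm]
    exact le_hadamardCov h1 h

end Hadamard

end HadamardFBM

theorem theorem3p3 {ν : Measure SchwartzDual} (hν : IsWhiteNoise ν) :
    -- comparison of the suprema for `α ∈ (0, 1)`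
    (∀ α ∈ Ioo (0 : ℝ) 1, ∀ Y : ℝ≥0 → SchwartzDual → ℝ,
      IsVersion hν α Y → IsSeparableProcess Y ν → ∀ t : ℝ≥0,
        (∀ᵐ ω ∂ν, PathBddAbove Y t ω) ∧ Integrable (runningSup Y t) ν ∧
        ∀ (Ω : Type*) [MeasurableSpace Ω] (P : Measure Ω) (B : ℝ≥0 → Ω → ℝ),
          IsBrownianReal B P →
          Integrable (runningSup B t) P ∧
          (∀ x : ℝ, P {ω | x < runningSup B t ω} ≤ ν {ω | x < runningSup Y t ω}) ∧
          ∫ ω, runningSup B t ω ∂P ≤ ∫ ω, runningSup Y t ω ∂ν) ∧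
    -- reversed comparison for `α ∈ (1, 2)`
    (∀ α ∈ Ioo (1 : ℝ) 2, ∀ Y : ℝ≥0 → SchwartzDual → ℝ,
      IsVersion hν α Y → IsSeparableProcess Y ν → ∀ t : ℝ≥0,
        (∀ᵐ ω ∂ν, PathBddAbove Y t ω) ∧ Integrable (runningSup Y t) ν ∧
        ∀ (Ω : Type*) [MeasurableSpace Ω] (P : Measure Ω) (B : ℝ≥0 → Ω → ℝ),
          IsBrownianReal B P →
          Integrable (runningSup B t) P ∧
          (∀ x : ℝ, ν {ω | x < runningSup Y t ω} ≤ P {ω | x < runningSup B t ω}) ∧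
          ∫ ω, runningSup Y t ω ∂ν ≤ ∫ ω, runningSup B t ω ∂P) ∧
    -- stochastic continuity
    (∀ α ∈ Ioo (0 : ℝ) 1 ∪ Ioo (1 : ℝ) 2, ∀ t : ℝ≥0,
      TendstoInMeasure ν (fun s => (hadamardFBM hν α s : SchwartzDual → ℝ))
        (𝓝 t) (hadamardFBM hν α t)) ∧
    -- continuity of the sample paths for `α ∈ (1, 2)`
    (∀ α ∈ Ioo (1 : ℝ) 2,
      (∃ Y : ℝ≥0 → SchwartzDual → ℝ, IsVersion hν α Y ∧
        (∀ t, Measurable (Y t)) ∧ ∀ ω, Continuous (fun t => Y t ω)) ∧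
      ∀ Y : ℝ≥0 → SchwartzDual → ℝ, IsVersion hν α Y → IsSeparableProcess Y ν →
        ∀ᵐ ω ∂ν, Continuous (fun t => Y t ω)) := by
  refine ⟨fun α hα Y hY hs t => ?_, fun α hα Y hY hs t => ?_,
    fun α hα t => tendstoInMeasure_hadamardFBM hν hα t, fun α hα => ⟨?_, fun Y hY hs => ?_⟩⟩
  · have hα' : α ∈ Ioo (0 : ℝ) 1 ∪ Ioo (1 : ℝ) 2 := Or.inl hα
    obtain ⟨hc, hi⟩ := continuous_of_isSeparableProcess hν hα' hY hs
    refine ⟨hc.mono fun ω hω => pathBddAbove_of_continuous hω t, hi t, fun Ω _ P B hB => ?_⟩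
    have hBi := integrable_runningSup_of_isBrownianReal hB t
    -- For `α < 1` the Hadamard process has the smaller covariances, hence the larger supremum; for
    -- `α > 1` the roles are exchanged.
    have hle := measure_lt_runningSup_le (isCenteredGaussian_of_isVersion hν hα' hY)
      (isCenteredGaussian_of_isPreBrownianReal hB.toIsPreBrownianReal) hc hB.cont
      (fun s => by rw [hadamardCov_self hα.1, min_self]) (hadamardCov_le_min hα.1 hα.2) t
    exact ⟨hBi, hle, integral_le_of_measure_lt_le (hi t) hBi
      (runningSup_nonneg hc (ae_eq_zero_of_isVersion hν hα' hY) t)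
      (runningSup_nonneg hB.cont hB.eval_zero_ae_eq_zero t) hle⟩
  · have hα' : α ∈ Ioo (0 : ℝ) 1 ∪ Ioo (1 : ℝ) 2 := Or.inr hα
    obtain ⟨hc, hi⟩ := continuous_of_isSeparableProcess hν hα' hY hs
    refine ⟨hc.mono fun ω hω => pathBddAbove_of_continuous hω t, hi t, fun Ω _ P B hB => ?_⟩
    have hBi := integrable_runningSup_of_isBrownianReal hB t
    have hle := measure_lt_runningSup_le
      (isCenteredGaussian_of_isPreBrownianReal hB.toIsPreBrownianReal)
      (isCenteredGaussian_of_isVersion hν hα' hY) hB.cont hc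
      (fun s => by rw [hadamardCov_self (pos_of_mem hα'), min_self]) (min_le_hadamardCov hα.1) t
    exact ⟨hBi, hle, integral_le_of_measure_lt_le hBi (hi t)
      (runningSup_nonneg hB.cont hB.eval_zero_ae_eq_zero t)
      (runningSup_nonneg hc (ae_eq_zero_of_isVersion hν hα' hY) t) hle⟩
  · obtain ⟨Z, hZm, hZc, hZ, -⟩ := exists_continuous_version hν (Or.inr hα)
    exact ⟨Z, hZ, hZm, hZc⟩
  · exact (continuous_of_isSeparableProcess hν (Or.inr hα) hY hs).1
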